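/- **Conventions.** Let $\mathbb N=\{0,1,2,\dots\}$. For subsets $A,B\subset X$ of $\mathbb N^n$, $(A,B)$ is an *$X$-pair* if $A+B=X$ and every $c\in X$ has exactly one decomposition $c=a+b$ with $a\in A$, $b\in B$. An *$\mathbb N^*$-pair* is an $\mathbb N^n$-pair for some $n\ge 1$. An $\mathbb N^n$-pair $(T,S)$ is *primitive* if it is not, up to a permutation of the coordinates, a Cartesian product $(I_1\times I_2,J_1\times J_2)$ of an $\mathbb N^k$-pair $(I_1,J_1)$ and an $\mathbb N^{n-k}$-pair $(I_2,J_2)$ with $1\le k<n$. An *interval pair of size $N\ge 1$* is a $\{0,1,\dots,N-1\}$-pair $(C,D)$ (for $N=1$ it is $(\{0\},\{0\})$). For $A\subset\mathbb N^n$ put $A(x)=\sum_{\mathbf a\in A}x^{\mathbf a}$, and for $\mathbf a\in(\mathbb N\setminus\{0\})^p$ put $L_{\mathbf a}=\mathbb N^p\setminus(\mathbb N^p+\mathbf a)$. **Weighted trees.** Let $(V,\Gamma)$ be a finite tree with root $\phi$. The offsprings of a node $u$ are its neighbours whose distance to $\phi$ is one more than that of $u$; a *top* is a node without offspring, and $V_0$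 is the set of tops. Assume that every node that is not a top has at least two offsprings. A *weight* is a quadruple $((T_0,S_0),\delta,\alpha,\Phi)$, where $(T_0,S_0)$ is an $\mathbb N$-pair (the initial pair), $\delta:V\setminus V_0\to\{0,1\}$, $\alpha:V\setminus\{\phi\}\to\mathbb N\setminus\{0\}$, $\Phi:V\setminus\{\phi\}\to\{\text{interval pairs}\}$, and, if $\phi$ is not a top, $\delta_\phi=1$ whenever $T_0=\{0\}$ and $\delta_\phi=0$ whenever $S_0=\{0\}$. **The generated pair.** It is defined recursively, the tops serving as variables. If $V=\{\phi\}$, it is $(T_0,S_0)$. Otherwise choose a node $z$ that is not a top and all of whose offsprings $x_1,\dots,x_p$ are tops; let $x_{p+1},\dots,x_n$ be the remaining tops and $\bar x=(x_{p+1},\dots,x_n)$. Delete $x_1,\dots,x_p$ from the tree, restrict the weight, and let $(\widetilde T,\widetilde S)$, in the variables $(z,\bar x)$, be the pair generated by the resulting tree. With $\delta=\delta_z$, $a_j=\alpha_{x_j}$, $\mathbf a=(a_1,\dots,a_p)$, $(C_j,D_j)=\Phi_{x_j}$ and $N_j$ the size of $(C_j,D_j)$, the generated pair $(T,S)$ is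 given by $$T(x)=\Big(\prod_{j=1}^pC_j(x_j)\Big)L_{\mathbf a}(x_1^{N_1},\dots,x_p^{N_p})^{\delta}\;\widetilde T\Big(\prod_{j=1}^px_j^{a_jN_j},\bar x\Big),$$ $$S(x)=\Big(\prod_{j=1}^pD_j(x_j)\Big)L_{\mathbf a}(x_1^{N_1},\dots,x_p^{N_p})^{1-\delta}\;\widetilde S\Big(\prod_{j=1}^px_j^{a_jN_j},\bar x\Big).$$ A pair of subsets of $\mathbb N^n$ is *generated by the weighted tree* if it arises in this way for some choice of the nodes $z$ and some numbering of the $n$ tops. **Theorem.** Let $n\ge 1$ and $T,S\subset\mathbb N^n$. Then $(T,S)$ is a primitive $\mathbb N^n$-pair if and only if it is generated by a weighted rooted tree with exactly $n$ tops. -/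

import Mathlib

open scoped Pointwise

namespace NPair

/-- `(A, B)` is a complementing pair of `X`: both sets lie in `X`, `A + B = X`, and the
decomposition `c = a + b` of each element of the sum is unique. -/
structure IsPairOf {M : Type*} [AddCommMonoid M] (X A B : Set M) : Prop where
  left_subset : A ⊆ X
  right_subset : B ⊆ X
  add_eq : A + B = X
  direct : Set.InjOn (fun p : M × M => p.1 + p.2) (A ×ˢ B)

/-- `(T, S)` is an `ℕ^ι`-pair. -/
def IsNPair {ι : Type*} (T S : Set (ι → ℕ)) : Prop :=
  IsPairOf Set.univ T S

/-- `(C, D)` is an interval pair of size `N`, that is, a `{0, …, N - 1}`-pair. The size `1`, for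
which `C = D = {0}`, is allowed. -/
structure IsIntervalPair (N : ℕ) (C D : Set ℕ) : Prop where
  one_le_size : 1 ≤ N
  pair : IsPairOf (Set.Iio N) C D

/-- The Cartesian product of `I₁ ⊆ ℕ^s` and `I₂ ⊆ ℕ^(sᶜ)`, as a subset of `ℕ^ι`. -/
def cartesian {ι : Type*} (s : Set ι) (I₁ : Set (s → ℕ)) (I₂ : Set ((sᶜ : Set ι) → ℕ)) :
    Set (ι → ℕ) :=
  {x | (fun i : s => x i) ∈ I₁ ∧ (fun i : (sᶜ : Set ι) => x i) ∈ I₂}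

/-- `(T, S)` is, up to the order of the coordinates, a Cartesian product of two pairs of lower
(positive) dimension. -/
def IsCartesianProduct {ι : Type*} (T S : Set (ι → ℕ)) : Prop :=
  ∃ s : Set ι, s.Nonempty ∧ sᶜ.Nonempty ∧
    ∃ (I₁ J₁ : Set (s → ℕ)) (I₂ J₂ : Set ((sᶜ : Set ι) → ℕ)),
      IsNPair I₁ J₁ ∧ IsNPair I₂ J₂ ∧ T = cartesian s I₁ I₂ ∧ S = cartesian s J₁ J₂

/-- `(T, S)` is a primitive `ℕ^ι`-pair. -/
def IsPrimitiveNPair {ι : Type*} (T S : Set (ι → ℕ)) : Prop :=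
  IsNPair T S ∧ ¬ IsCartesianProduct T S

/-- A rooted tree with node set `V`. -/
structure RootedTree (V : Type*) where
  graph : SimpleGraph V
  isTree : graph.IsTree
  root : V

namespace RootedTree

variable {V : Type*} (Γ : RootedTree V)

/-- The level of a node: the length of the path joining it to the root. -/
noncomputable def level (v : V) : ℕ := Γ.graph.dist Γ.root v

/-- The set of offsprings of `u`. -/
def offspring (u : V) : Set V := {v | Γ.graph.Adj u v ∧ Γ.level v = Γ.level u + 1}

/-- A top is a node without offspring. -/
def IsTop (v : V) : Prop := Γ.offspring v = ∅

/-- Every node that is not a top has at least two offsprings. -/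
def IsBranching : Prop := ∀ v, ¬ Γ.IsTop v → (Γ.offspring v).Nontrivial

end RootedTree

/-- A weight of a rooted tree. The maps `α`, `C`, `D`, `size` matter only at nodes other than the
root, and `δ` only at nodes that are not tops; the values elsewhere are neither constrained nor
used. `Φ v = (C v, D v)` is the interval pair attached to `v`, and `size v` is its size. -/
structure Weight {V : Type*} (Γ : RootedTree V) where
  T₀ : Set ℕ
  S₀ : Set ℕ
  initial : IsPairOf Set.univ T₀ S₀
  δ : V → Fin 2
  α : V → ℕ
  C : V → Set ℕ
  D : V → Set ℕ
  size : V → ℕ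
  α_pos : ∀ v, v ≠ Γ.root → 0 < α v
  interval : ∀ v, v ≠ Γ.root → IsIntervalPair (size v) (C v) (D v)
  δ_root_of_left : ¬ Γ.IsTop Γ.root → T₀ = {0} → δ Γ.root = 1
  δ_root_of_right : ¬ Γ.IsTop Γ.root → S₀ = {0} → δ Γ.root = 0

section Generation

variable {V : Type*}

/-- The set with power series `∏_{v ∈ B} (C v)(v)`; the nodes are used as variables, and a monomial
in them is identified with its exponent vector in `V → ℕ`. -/
def box (B : Set V) (C : V → Set ℕ) : Set (V → ℕ) :=
  {y | (∀ v ∈ B, y v ∈ C v) ∧ ∀ v ∉ B, y v = 0}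

/-- `L_a = ℕ^B ∖ (ℕ^B + a)`, in the variables of `B`. -/
def corner (B : Set V) (a : V → ℕ) : Set (V → ℕ) :=
  {y | (∀ v ∉ B, y v = 0) ∧ ¬ ∀ v ∈ B, a v ≤ y v}

/-- The set with power series `L_a^ε` evaluated at `v ↦ v ^ N v`, for `ε ∈ {0, 1}`. -/
def cornerPow (B : Set V) (a N : V → ℕ) (ε : Fin 2) : Set (V → ℕ) :=
  if ε = 1 then (fun y v => N v * y v) '' corner B a else {0}

open Classical in
/-- The effect on exponent vectors of the substitution `z ↦ ∏_{v ∈ B} v ^ b v`. -/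
noncomputable def substitute (z : V) (B : Set V) (b : V → ℕ) (t : V → ℕ) : V → ℕ :=
  fun v => if v ∈ B then t z * b v else if v = z then 0 else t v

/-- The set with power series
`(∏_{v ∈ B} (C v)(v)) * L_a^ε (v ^ N v : v ∈ B) * T(z ↦ ∏_{v ∈ B} v ^ (a v * N v))`:
a second type extension along the variable `z`, with parameters `ε` and `a`, followed by
first type extensions along all the variables in `B`. A product of power series with
coefficients in `{0, 1}` corresponds to a sum of sets. -/
noncomputable def extend (z : V) (B : Set V) (C : V → Set ℕ) (a N : V → ℕ) (ε : Fin 2)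
    (T : Set (V → ℕ)) : Set (V → ℕ) :=
  box B C + cornerPow B a N ε + substitute z B (fun v => a v * N v) '' T

/-- `Generates W U T S`: the pair `(T, S)`, in the variables the tops of the subtree with node set
`U`, is generated by this subtree with the restricted weight. The definition is by recursion on the
subtree: the subtree consisting of the root alone generates the initial pair; otherwise one chooses
a node `z` of the subtree that is not a top in it and all of whose offsprings are tops in it,
removes the offsprings of `z`, and extends the pair generated by the smaller subtree. The set `U`
runs over the node sets that arise from `V` by such removals. -/
inductive Generates {Γ : RootedTree V} (W : Weight Γ) :
    Set V → Set (V → ℕ) → Set (V → ℕ) → Prop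
  | root : Generates W {Γ.root} (box {Γ.root} fun _ => W.T₀) (box {Γ.root} fun _ => W.S₀)
  | branch (U : Set V) (z : V) (T S : Set (V → ℕ)) (mem : z ∈ U)
      (nonempty : (Γ.offspring z).Nonempty) (subset : Γ.offspring z ⊆ U)
      (tops : ∀ x ∈ Γ.offspring z, Disjoint (Γ.offspring x) U)
      (ih : Generates W (U \ Γ.offspring z) T S) :
      Generates W U
        (extend z (Γ.offspring z) W.C W.α W.size (W.δ z) T)
        (extend z (Γ.offspring z) W.D W.α W.size (1 - W.δ z) S)

/-- The weighted tree `(Γ, W)`, whose tops are listed as `x₁, …, xₙ` by `e`, generates the pair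
`(T, S)` of subsets of `ℕ^n`. -/
def IsGeneratedBy {Γ : RootedTree V} (W : Weight Γ) {n : ℕ} (e : Fin n ≃ {v // Γ.IsTop v})
    (T S : Set (Fin n → ℕ)) : Prop :=
  ∃ T' S' : Set (V → ℕ), Generates W Set.univ T' S' ∧
    T = (fun y i => y (e i)) '' T' ∧ S = (fun y i => y (e i)) '' S'

end Generation

end NPair

/-! From trees to pairs, one inducts on the removals; the point is that an extension along `z`
creates no splitting. The member that does not receive the factor `L_a` must contain a vector with
nonzero exponent at `z`. Its image has positive exponents at all the new variables at once, so no
splitting can separate them, and a splitting that keeps them together descends to the smaller pair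
(`IsPrimitiveOn.extend_one`). At the root such a vector exists by the constraints on `δ`; later it
exists because a variable absent from one member of a pair splits off
(`IsPrimitiveOn.exists_ne_zero`).

From pairs to trees, one shows that a primitive pair in at least two variables is such an extension.
Take a minimal set `B` of variables for which one of the members, on the face `ℕ^B`, is not the
product of its axes. First type reductions along `B` make each axis in `B` lie wholly in one member;
if they could go on forever, a variable would split off (`IsNPair.exists_reduces_pure`). For the
reduced pair, minimality of `B` forces all these axes into the same member, say `T`. Then the proper
faces of `ℕ^B` lie in `T`, and a minimal nonzero `a` in `S ∩ ℕ^B` satisfies `L_a ⊆ T`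
(`IsNPair.exists_corner`).

The decisive step is `IsNPair.mem_base_fibre`. Every vector is uniquely a base vector, whose part in
`B` is a multiple of `a`, plus an element of `L_a`. The inclusions `L_a ⊆ T` and `a ∈ S` force `T`
to be a union of full translates of `L_a` by base vectors, and `S` to consist of base vectors.
Contracting `B` to one variable therefore gives a primitive pair in fewer variables. By induction it
comes from a tree, and grafting `B` onto the top of the contracted variable gives the required tree
(`IsRealizable.extendVec`). -/

namespace NPair

/-! ### Complementing pairs and interval pairs -/

section Basic

variable {M : Type*} [AddCommMonoid M] {X A B : Set M}

theorem IsPairOf.exists_add (h : IsPairOf X A B) {c : M} (hc : c ∈ X) :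
    ∃ a ∈ A, ∃ b ∈ B, a + b = c := by
  rw [← h.add_eq] at hc
  exact Set.mem_add.1 hc

theorem IsPairOf.add_mem (h : IsPairOf X A B) {a b : M} (ha : a ∈ A) (hb : b ∈ B) :
    a + b ∈ X := by
  rw [← h.add_eq]
  exact Set.add_mem_add ha hb

theorem IsPairOf.eq_and_eq (h : IsPairOf X A B) {a a' b b' : M} (ha : a ∈ A) (ha' : a' ∈ A)
    (hb : b ∈ B) (hb' : b' ∈ B) (e : a + b = a' + b') : a = a' ∧ b = b' := by
  have := h.direct (Set.mk_mem_prod ha hb) (Set.mk_mem_prod ha' hb') e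
  simpa using this

theorem IsPairOf.of_exists_unique (hA : A ⊆ X) (hB : B ⊆ X)
    (hadd : ∀ a ∈ A, ∀ b ∈ B, a + b ∈ X) (hex : ∀ c ∈ X, ∃ a ∈ A, ∃ b ∈ B, a + b = c)
    (huniq : ∀ a ∈ A, ∀ a' ∈ A, ∀ b ∈ B, ∀ b' ∈ B, a + b = a' + b' → a = a' ∧ b = b') :
    IsPairOf X A B where
  left_subset := hA
  right_subset := hB
  add_eq := by
    ext c
    constructor
    · rintro ⟨a, ha, b, hb, rfl⟩
      exact hadd a ha b hb
    · intro hc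
      exact Set.mem_add.2 (hex c hc)
  direct := by
    rintro ⟨a, b⟩ ⟨ha, hb⟩ ⟨a', b'⟩ ⟨ha', hb'⟩ e
    obtain ⟨h1, h2⟩ := huniq a ha a' ha' b hb b' hb' e
    simp [h1, h2]

theorem IsPairOf.symm (h : IsPairOf X A B) : IsPairOf X B A := by
  refine .of_exists_unique h.right_subset h.left_subset ?_ ?_ ?_
  · intro a ha b hb
    rw [add_comm]
    exact h.add_mem hb ha
  · intro c hc
    obtain ⟨a, ha, b, hb, e⟩ := h.exists_add hc
    exact ⟨b, hb, a, ha, by rw [add_comm, e]⟩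
  · intro a ha a' ha' b hb b' hb' e
    exact (h.eq_and_eq hb hb' ha ha' (by rw [add_comm b, add_comm b', e])).symm

theorem IsIntervalPair.symm {N : ℕ} {C D : Set ℕ} (h : IsIntervalPair N C D) :
    IsIntervalPair N D C := ⟨h.one_le_size, h.pair.symm⟩

theorem IsPairOf.zero_mem (h : IsPairOf X A B)
    (h0 : (0 : M) ∈ X) (hc : ∀ a b : M, a + b = 0 → a = 0) : (0 : M) ∈ A := by
  obtain ⟨a, ha, b, hb, e⟩ := h.exists_add h0
  rwa [← hc a b e]

theorem IsIntervalPair.zero_mem {N : ℕ} {C D : Set ℕ} (h : IsIntervalPair N C D) : 0 ∈ C :=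
  h.pair.zero_mem (Set.mem_Iio.2 h.one_le_size) (fun a b => by omega)

theorem IsIntervalPair.lt {N : ℕ} {C D : Set ℕ} (h : IsIntervalPair N C D) {c : ℕ} (hc : c ∈ C) :
    c < N := h.pair.left_subset hc

end Basic

/-! ### Cartesian products as splittings along faces -/

section Split

variable {ι : Type*} {T S : Set (ι → ℕ)}

theorem IsNPair.symm (h : IsNPair T S) : IsNPair S T := IsPairOf.symm h

theorem IsNPair.zero_mem (h : IsNPair T S) : 0 ∈ T := by
  refine IsPairOf.zero_mem h (Set.mem_univ _) fun a b e => ?_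
  ext i
  have := congrFun e i
  simp only [Pi.add_apply, Pi.zero_apply] at this ⊢
  omega

theorem IsNPair.exists_add (h : IsNPair T S) (c : ι → ℕ) : ∃ t ∈ T, ∃ s ∈ S, t + s = c :=
  IsPairOf.exists_add h (Set.mem_univ c)

theorem IsNPair.eq_and_eq (h : IsNPair T S) {t t' s s' : ι → ℕ} (ht : t ∈ T) (ht' : t' ∈ T)
    (hs : s ∈ S) (hs' : s' ∈ S) (e : t + s = t' + s') : t = t' ∧ s = s' :=
  IsPairOf.eq_and_eq h ht ht' hs hs' e

theorem IsNPair.eq_zero (h : IsNPair T S) {x : ι → ℕ} (ht : x ∈ T) (hs : x ∈ S) : x = 0 :=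
  (h.eq_and_eq ht h.zero_mem h.symm.zero_mem hs (by rw [add_zero, zero_add])).1

/-- The set `T` is the product of its intersections with the faces `ℕ^s` and `ℕ^(sᶜ)`. -/
def SplitsAt (s : Set ι) (T : Set (ι → ℕ)) : Prop :=
  ∀ x, x ∈ T ↔ s.indicator x ∈ T ∧ sᶜ.indicator x ∈ T

theorem SplitsAt.compl {s : Set ι} (h : SplitsAt s T) : SplitsAt sᶜ T := by
  intro x
  rw [compl_compl, and_comm]
  exact h x

open Classical in
/-- Extension by zero of an exponent vector on a face. -/
noncomputable def extendZero (s : Set ι) (y : s → ℕ) : ι → ℕ :=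
  fun i => if h : i ∈ s then y ⟨i, h⟩ else 0

theorem extendZero_restrict (s : Set ι) (x : ι → ℕ) :
    extendZero s (fun i : s => x i) = s.indicator x := by
  classical
  ext i
  by_cases h : i ∈ s <;> simp [extendZero, h]

theorem extendZero_injective (s : Set ι) : Function.Injective (extendZero (ι := ι) s) := by
  intro y y' e
  ext ⟨i, hi⟩
  have := congrFun e i
  simpa [extendZero, hi] using this

theorem extendZero_add (s : Set ι) (y y' : s → ℕ) :
    extendZero s (y + y') = extendZero s y + extendZero s y' := by
  ext i
  by_cases h : i ∈ s <;> simp [extendZero, h]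

theorem IsNPair.face (h : IsNPair T S) (s : Set ι) :
    IsNPair (extendZero s ⁻¹' T) (extendZero s ⁻¹' S) := by
  refine IsPairOf.of_exists_unique (Set.subset_univ _) (Set.subset_univ _)
    (fun _ _ _ _ => Set.mem_univ _) ?_ ?_
  · intro y _
    obtain ⟨t, ht, u, hu, e⟩ := h.exists_add (extendZero s y)
    have hz : ∀ i ∉ s, t i = 0 ∧ u i = 0 := by
      intro i hi
      have := congrFun e i
      simp only [Pi.add_apply, extendZero, hi, dite_false] at this
      omega
    have h1 : extendZero s (fun i : s => t i) = t := by
      rw [extendZero_restrict, Set.indicator_eq_self]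
      intro i hi
      by_contra hc
      exact hi (hz i hc).1
    have h2 : extendZero s (fun i : s => u i) = u := by
      rw [extendZero_restrict, Set.indicator_eq_self]
      intro i hi
      by_contra hc
      exact hi (hz i hc).2
    refine ⟨fun i : s => t i, by simpa [h1] using ht, fun i : s => u i, by simpa [h2] using hu, ?_⟩
    apply extendZero_injective
    rw [extendZero_add, h1, h2, e]
  · intro a ha a' ha' b hb b' hb' e
    have := h.eq_and_eq ha ha' hb hb' (by rw [← extendZero_add, ← extendZero_add, e])
    exact ⟨extendZero_injective s this.1, extendZero_injective s this.2⟩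

theorem SplitsAt.eq_cartesian {s : Set ι} (h : SplitsAt s T) :
    T = cartesian s (extendZero s ⁻¹' T) (extendZero sᶜ ⁻¹' T) := by
  ext x
  simp only [cartesian, Set.mem_ofPred_eq, Set.mem_preimage, extendZero_restrict]
  exact h x

theorem splitsAt_cartesian {s : Set ι} {I : Set (s → ℕ)} {J : Set ((sᶜ : Set ι) → ℕ)}
    (h0 : 0 ∈ cartesian s I J) : SplitsAt s (cartesian s I J) := by
  intro x
  have h1 : (fun i : s => s.indicator x i) = fun i : s => x i := by
    ext i
    simp
  have h2 : (fun i : (sᶜ : Set ι) => s.indicator x i) = fun i => 0 := by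
    ext i
    have : (i : ι) ∉ s := i.2
    simp [this]
  have h3 : (fun i : (sᶜ : Set ι) => sᶜ.indicator x i) = fun i : (sᶜ : Set ι) => x i := by
    ext i
    simp
  have h4 : (fun i : s => sᶜ.indicator x i) = fun i => 0 := by
    ext i
    simp
  have h01 : (fun _ : s => 0) ∈ I := h0.1
  have h02 : (fun _ : (sᶜ : Set ι) => 0) ∈ J := h0.2
  simp only [cartesian, Set.mem_ofPred_eq, h1, h2, h3, h4, h01, h02, and_true, true_and]

/-- Both members contain `0`, so the factors of a product are its intersections with the two faces;
these are pairs by `IsNPair.face`, since summands of a vector on a face stay on that face. -/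
theorem IsNPair.isCartesianProduct_iff (h : IsNPair T S) :
    IsCartesianProduct T S ↔
      ∃ s : Set ι, s.Nonempty ∧ sᶜ.Nonempty ∧ SplitsAt s T ∧ SplitsAt s S := by
  constructor
  · rintro ⟨s, hs, hs', I₁, J₁, I₂, J₂, -, -, rfl, rfl⟩
    exact ⟨s, hs, hs', splitsAt_cartesian h.zero_mem, splitsAt_cartesian h.symm.zero_mem⟩
  · rintro ⟨s, hs, hs', hT, hS⟩
    exact ⟨s, hs, hs', _, _, _, _, h.face s, h.face sᶜ, hT.eq_cartesian, hS.eq_cartesian⟩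

end Split

/-! ### Base vectors, corners and the fibre lemma -/

section Peel

variable {ι : Type*} {B : Set ι} {a : ι → ℕ}

/-- The coordinates of `x` in `B` form a multiple of `a`. -/
def IsBase (B : Set ι) (a : ι → ℕ) (x : ι → ℕ) : Prop := ∃ k, ∀ i ∈ B, x i = k * a i

theorem exists_isBase_add_corner (hB : B.Nonempty) (ha : ∀ i ∈ B, 0 < a i) (x : ι → ℕ) :
    ∃ b l, IsBase B a b ∧ l ∈ corner B a ∧ b + l = x := by
  classical
  obtain ⟨j, hj⟩ := hB
  -- The least such `k` gives the largest multiple of `a` below `x` on `B`. The witness `x j` works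
  -- because `a j` is positive.
  have hex : ∃ k, ¬ ∀ i ∈ B, (k + 1) * a i ≤ x i := by
    refine ⟨x j, fun h => ?_⟩
    have h1 := h j hj
    have h2 := ha j hj
    nlinarith
  have hk := Nat.find_spec hex
  have hle : ∀ i ∈ B, Nat.find hex * a i ≤ x i := by
    by_cases h0 : Nat.find hex = 0
    · intro i _
      rw [h0, zero_mul]
      exact Nat.zero_le _
    · have := Nat.find_min hex (Nat.pred_lt h0)
      rw [not_not, Nat.pred_eq_sub_one, Nat.sub_add_cancel (Nat.one_le_iff_ne_zero.2 h0)] at this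
      exact this
  generalize Nat.find hex = k at hk hle
  refine ⟨fun i => if i ∈ B then k * a i else x i, fun i => if i ∈ B then x i - k * a i else 0,
    ⟨k, fun i hi => by simp [hi]⟩, ⟨fun i hi => by simp [hi], fun h => hk fun i hi => ?_⟩, ?_⟩
  · have h1 := h i hi
    have h2 := hle i hi
    simp only [hi, if_true] at h1
    rw [add_mul, one_mul]
    omega
  · ext i
    by_cases hi : i ∈ B
    · have := hle i hi
      simp only [Pi.add_apply, hi, if_true]
      omega
    · simp [hi]

/-- At a coordinate `j` with `l j < a j`, the multiple occurring in `b` is the largest that fits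
under `b + l`. Comparing both ways gives uniqueness of the base part. -/
theorem IsBase.le_of_add_le {b b' l l' : ι → ℕ} (hb : IsBase B a b) (hb' : IsBase B a b')
    (hl : l ∈ corner B a) (hl' : l' ∈ corner B a) (h : b' + l' ≤ b + l) : b' ≤ b := by
  obtain ⟨k, hk⟩ := hb
  obtain ⟨k', hk'⟩ := hb'
  obtain ⟨hl0, hl1⟩ := hl
  push Not at hl1
  obtain ⟨j, hj, hlj⟩ := hl1
  have hkk : k' ≤ k := by
    by_contra hc
    have h1 := h j
    simp only [Pi.add_apply, hk j hj, hk' j hj] at h1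
    have h2 : (k + 1) * a j ≤ k' * a j := Nat.mul_le_mul_right _ (by omega)
    rw [add_mul, one_mul] at h2
    omega
  intro i
  by_cases hi : i ∈ B
  · rw [hk i hi, hk' i hi]
    exact Nat.mul_le_mul_right _ hkk
  · have h1 := h i
    simpa [hl0 i hi, hl'.1 i hi] using h1

theorem IsBase.sub {b b' : ι → ℕ} (hb : IsBase B a b) (hb' : IsBase B a b') :
    IsBase B a (b - b') := by
  obtain ⟨k, hk⟩ := hb
  obtain ⟨k', hk'⟩ := hb'
  exact ⟨k - k', fun i hi => by simp [hk i hi, hk' i hi, Nat.sub_mul]⟩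

theorem IsBase.eq_of_add_eq {b b' l l' : ι → ℕ} (hb : IsBase B a b) (hb' : IsBase B a b')
    (hl : l ∈ corner B a) (hl' : l' ∈ corner B a) (h : b + l = b' + l') : b = b' ∧ l = l' := by
  have h1 : b = b' := le_antisymm (hb'.le_of_add_le hb hl' hl h.le) (hb.le_of_add_le hb' hl hl' h.ge)
  subst h1
  exact ⟨rfl, add_left_cancel h⟩

theorem zero_mem_corner (hB : B.Nonempty) (ha : ∀ i ∈ B, 0 < a i) : 0 ∈ corner B a := by
  obtain ⟨j, hj⟩ := hB
  refine ⟨fun _ _ => rfl, fun h => ?_⟩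
  have h1 := h j hj
  have h2 := ha j hj
  simp only [Pi.zero_apply] at h1
  omega

theorem corner_of_le {l l' : ι → ℕ} (hl : l ∈ corner B a) (h : l' ≤ l) : l' ∈ corner B a := by
  refine ⟨fun i hi => ?_, fun hc => hl.2 fun i hi => (hc i hi).trans (h i)⟩
  have h1 := h i
  rw [hl.1 i hi] at h1
  exact Nat.le_zero.1 h1

variable {T S : Set (ι → ℕ)}

/-- Induction on `b`, distinguishing whether `b` lies in `S`, in `T`, or in neither. In each case an
explicit decomposition of the vectors `b + l` contradicts uniqueness unless the fibre behaves as
claimed. -/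
theorem IsNPair.mem_base_fibre [Finite ι] (h : IsNPair T S) (hB : B.Nonempty)
    (ha : ∀ i ∈ B, 0 < a i) (ha0 : ∀ i ∉ B, a i = 0) (hL : corner B a ⊆ T) (haS : a ∈ S)
    (b : ι → ℕ) (hb : IsBase B a b) :
    (∀ l ∈ corner B a, b + l ∈ T ↔ b ∈ T) ∧ ∀ l ∈ corner B a, b + l ∈ S → l = 0 := by
  induction b using WellFoundedLT.induction with
  | ind b ih =>
  have hc0 := zero_mem_corner hB ha
  have haB : IsBase B a a := ⟨1, fun i _ => by simp⟩
  -- By induction, the only elements of `S` below `b + l` are smaller base vectors and elements of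
  -- the fibre over `b` itself.
  have base_of_mem : ∀ s ∈ S, ∀ l ∈ corner B a, s ≤ b + l →
      (IsBase B a s ∧ s < b) ∨ ∃ m ∈ corner B a, s = b + m := by
    intro s hs l hl hle
    obtain ⟨b', l', hb', hl', rfl⟩ := exists_isBase_add_corner hB ha s
    have hbb := hb.le_of_add_le hb' hl hl' hle
    rcases hbb.lt_or_eq with hlt | rfl
    · left
      obtain rfl := (ih b' hlt hb').2 l' hl' hs
      rw [add_zero]
      exact ⟨hb', hlt⟩
    · exact Or.inr ⟨l', hl', rfl⟩
  by_cases hbS : b ∈ S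
  -- Here `l + b`, with `l ∈ T` and `b ∈ S`, is the decomposition of `b + l`.
  · refine ⟨fun l hl => ?_, fun l hl hs => ?_⟩
    · by_cases hb0 : b = 0
      · subst hb0
        simp [hL hl, hL hc0]
      · refine iff_of_false (fun hT => hb0 ?_) fun hT => hb0 (h.eq_zero hT hbS)
        exact (h.eq_and_eq (hL hl) hT hbS h.symm.zero_mem (by rw [add_zero, add_comm])).2
    · exact (h.eq_and_eq (hL hc0) (hL hl) hs hbS (by rw [zero_add, add_comm])).1.symm
  by_cases hbT : b ∈ T
  -- If the `S`-part `s` of `b + l` were a nonzero base vector below `b`, then `b - s ∈ T` by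
  -- induction, and `(b - s) + s` would be a second decomposition of `b ∈ T`.
  · have key : ∀ l ∈ corner B a, (∀ m ∈ corner B a, m ≤ l → b + m ∉ S) → b + l ∈ T := by
      intro l hl hm
      obtain ⟨t, ht, s, hs, e⟩ := h.exists_add (b + l)
      have hsle : s ≤ b + l := by rw [← e]; exact le_add_self
      rcases base_of_mem s hs l hl hsle with ⟨hsB, hsb⟩ | ⟨m, hmc, rfl⟩
      · by_cases hs0 : s = 0
        · rwa [← e, hs0, add_zero]
        · exfalso
          have hbs : b - s + s = b := tsub_add_cancel_of_le hsb.le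
          have hlt : b - s < b := by
            refine lt_of_le_of_ne tsub_le_self fun hc => hs0 ?_
            rw [hc] at hbs
            exact left_eq_add.1 hbs.symm
          have ht' : t = b - s + l := by
            have : t + s = b - s + l + s := by rw [e, add_right_comm, hbs]
            exact add_right_cancel this
          have := ((ih _ hlt (hb.sub hsB)).1 l hl).1 (ht' ▸ ht)
          exact hs0 (h.eq_and_eq this hbT hs h.symm.zero_mem (by rw [hbs, add_zero])).2
      · refine absurd hs (hm m hmc ?_)
        exact (add_le_add_iff_left b).1 hsle
    have hS : ∀ m, m ∈ corner B a → b + m ∉ S := by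
      intro m
      induction m using WellFoundedLT.induction with
      | ind m ihm =>
      intro hm hs
      have hm0 : m ≠ 0 := by
        rintro rfl
        rw [add_zero] at hs
        exact hbS hs
      have hlt : m - a < m := by
        refine lt_of_le_of_ne tsub_le_self fun hc => hm0 ?_
        ext i
        have h1 := congrFun hc i
        simp only [Pi.sub_apply] at h1
        by_cases hi : i ∈ B
        · have := ha i hi
          simp only [Pi.zero_apply]
          omega
        · exact hm.1 i hi
      have hx : b + (m - a) ∈ T := by
        refine key _ (corner_of_le hm hlt.le) fun m' hm' hle => ihm m' (hle.trans_lt hlt) hm'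
      have ham : a - m ∈ corner B a := by
        refine ⟨fun i hi => by simp [ha0 i hi], fun hc => hm0 ?_⟩
        ext i
        by_cases hi : i ∈ B
        · have h1 := hc i hi
          have h2 := ha i hi
          simp only [Pi.sub_apply, Pi.zero_apply] at h1 ⊢
          omega
        · exact hm.1 i hi
      -- With truncated subtraction both sides are `b + max m a`. Uniqueness gives `a = b + m`; as
      -- `a` is a base vector, its corner part `m` vanishes.
      have e : b + (m - a) + a = (a - m) + (b + m) := by
        ext i
        simp only [Pi.add_apply, Pi.sub_apply]
        omega
      have h2 := (h.eq_and_eq hx (hL ham) haS hs e).2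
      have h3 := (haB.eq_of_add_eq hb hc0 hm (by rw [add_zero, h2])).2
      exact hm0 h3.symm
    exact ⟨fun l hl => iff_of_true (key l hl fun m hm _ => hS m hm) hbT,
      fun l hl hs => absurd hs (hS l hl)⟩
  -- Now `b = t + s` with `s ≠ 0`, and `t` is a smaller base vector. Its fibre lies in `T` by
  -- induction, so `(t + l) + s` decomposes every `b + l`.
  · obtain ⟨t, ht, s, hs, e⟩ := h.exists_add b
    have hs0 : s ≠ 0 := by
      rintro rfl
      rw [add_zero] at e
      exact hbT (e ▸ ht)
    have hsle : s ≤ b := by rw [← e]; exact le_add_self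
    rcases base_of_mem s hs 0 hc0 (by simpa using hsle) with ⟨hsB, hsb⟩ | ⟨m, -, rfl⟩
    · have ht' : t = b - s := by rw [← e, add_tsub_cancel_right]
      have hlt : t < b := by
        refine lt_of_le_of_ne (ht' ▸ tsub_le_self) fun hc => hs0 ?_
        rw [hc] at e
        exact add_eq_left.1 e
      have hfib := (ih t hlt (ht' ▸ hb.sub hsB)).1
      have hdec : ∀ l, b + l = (t + l) + s := fun l => by rw [← e, add_right_comm]
      refine ⟨fun l hl => iff_of_false (fun hT => hs0 ?_) hbT, fun l hl hS => ?_⟩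
      · exact (h.eq_and_eq ((hfib l hl).2 ht) hT hs h.symm.zero_mem
          (by rw [add_zero, hdec])).2
      · have := (h.eq_and_eq ((hfib l hl).2 ht) (hL hc0) hs hS (by rw [zero_add, hdec])).2
        rw [this] at hsb
        exact absurd hsb (not_lt_of_ge le_self_add)
    · have : b + m = b := le_antisymm hsle le_self_add
      rw [this] at hs
      exact absurd hs hbS

end Peel

/-! ### First type reductions -/

section Reduction

variable {ι : Type*} {T S : Set (ι → ℕ)}

/-- The exponent vectors of `T` divisible by `N`, divided by `N`. -/
def scaled (N : ι → ℕ) (T : Set (ι → ℕ)) : Set (ι → ℕ) := {y | N * y ∈ T}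

theorem mem_scaled {N y : ι → ℕ} : y ∈ scaled N T ↔ N * y ∈ T := Iff.rfl

/-- The pair `(T, S)` arises from `(scaled N T, scaled N S)` by first type extensions with the
interval pairs `(C i, D i)` of sizes `N i`. -/
structure Reduces (T S : Set (ι → ℕ)) (N : ι → ℕ) (C D : ι → Set ℕ) : Prop where
  interval : ∀ i, IsIntervalPair (N i) (C i) (D i)
  left : ∀ x, x ∈ T ↔ (∀ i, x i % N i ∈ C i) ∧ x / N ∈ scaled N T
  right : ∀ x, x ∈ S ↔ (∀ i, x i % N i ∈ D i) ∧ x / N ∈ scaled N S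

variable {N : ι → ℕ} {C D : ι → Set ℕ}

theorem Reduces.symm (h : Reduces T S N C D) : Reduces S T N D C :=
  ⟨fun i => (h.interval i).symm, h.right, h.left⟩

/-- Residues of an element of `T` and an element of `S` add without carry, because `C i + D i` stays
below `N i`. Hence the quotients of a decomposition of `N * c` add up to `c`. -/
theorem Reduces.isNPair (hr : Reduces T S N C D) (h : IsNPair T S) :
    IsNPair (scaled N T) (scaled N S) := by
  refine IsPairOf.of_exists_unique (Set.subset_univ _) (Set.subset_univ _)
    (fun _ _ _ _ => Set.mem_univ _) ?_ ?_
  · intro c _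
    obtain ⟨t, ht, s, hs, e⟩ := h.exists_add (N * c)
    obtain ⟨ht1, ht2⟩ := (hr.left t).1 ht
    obtain ⟨hs1, hs2⟩ := (hr.right s).1 hs
    refine ⟨t / N, ht2, s / N, hs2, ?_⟩
    ext i
    have h1 : t i % N i + s i % N i < N i := (hr.interval i).pair.add_mem (ht1 i) (hs1 i)
    have h2 : t i + s i = N i * c i := congrFun e i
    have h3 := Nat.div_add_mod (t i) (N i)
    have h4 := Nat.div_add_mod (s i) (N i)
    have h5 : (N i * (t i / N i + s i / N i) + (t i % N i + s i % N i)) / N i = c i := by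
      have : N i * (t i / N i + s i / N i) + (t i % N i + s i % N i) = N i * c i := by
        rw [mul_add]
        omega
      rw [this, Nat.mul_div_cancel_left _ (hr.interval i).one_le_size]
    rw [Nat.mul_add_div (hr.interval i).one_le_size, Nat.div_eq_of_lt h1, add_zero] at h5
    exact h5
  · intro a ha a' ha' b hb b' hb' e
    have h1 := h.eq_and_eq ha ha' hb hb' (by rw [← mul_add, ← mul_add, e])
    have hinj : ∀ y y' : ι → ℕ, N * y = N * y' → y = y' := by
      intro y y' hy
      ext i
      exact Nat.eq_of_mul_eq_mul_left (hr.interval i).one_le_size (congrFun hy i)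
    exact ⟨hinj _ _ h1.1, hinj _ _ h1.2⟩

theorem isPairOf_singleton {M : Type*} [AddCommMonoid M] {X : Set M} (h0 : 0 ∈ X) :
    IsPairOf X X {0} := by
  refine .of_exists_unique subset_rfl (by simpa using h0) ?_ ?_ ?_
  · rintro a ha _ rfl
    rwa [add_zero]
  · intro c hc
    exact ⟨c, hc, 0, rfl, add_zero c⟩
  · rintro a - a' - _ rfl _ rfl e
    simpa using e

theorem isIntervalPair_Iio {n : ℕ} (hn : 1 ≤ n) : IsIntervalPair n (Set.Iio n) {0} :=
  ⟨hn, isPairOf_singleton (Set.mem_Iio.2 hn)⟩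

theorem reduces_one : Reduces T S 1 (fun _ => {0}) (fun _ => {0}) := by
  have hs : ∀ R : Set (ι → ℕ), scaled 1 R = R := fun R => by ext y; simp [mem_scaled]
  have hd : ∀ x : ι → ℕ, x / 1 = x := fun x => by ext i; simp
  refine ⟨fun i => ?_, fun x => ?_, fun x => ?_⟩
  · have h1 : (Set.Iio 1 : Set ℕ) = {0} := by ext; simp
    have := isIntervalPair_Iio (le_refl 1)
    rwa [h1] at this
  · simp [hs, hd, Nat.mod_one]
  · simp [hs, hd, Nat.mod_one]

/-- Two-digit mixed radix expansion: digits add without carry. This is what lets reductions be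
composed in `Reduces.trans`. -/
theorem IsIntervalPair.mul {N N' : ℕ} {C D C' D' : Set ℕ} (h : IsIntervalPair N C D)
    (h' : IsIntervalPair N' C' D') :
    IsIntervalPair (N * N') {c | c % N ∈ C ∧ c / N ∈ C'} {c | c % N ∈ D ∧ c / N ∈ D'} := by
  have hN := h.one_le_size
  have hsub : ∀ {C C' D D' : Set ℕ}, IsIntervalPair N C D → IsIntervalPair N' C' D' →
      {c | c % N ∈ C ∧ c / N ∈ C'} ⊆ Set.Iio (N * N') := by
    rintro C C' D D' - h' c ⟨-, h2⟩
    have := h'.lt h2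
    rw [Nat.div_lt_iff_lt_mul hN, mul_comm] at this
    exact this
  have hadd : ∀ c d : ℕ, c % N ∈ C → d % N ∈ D →
      (c + d) % N = c % N + d % N ∧ (c + d) / N = c / N + d / N := by
    intro c d hc hd
    have hlt : c % N + d % N < N := h.pair.add_mem hc hd
    have e : c + d = N * (c / N + d / N) + (c % N + d % N) := by
      have h3 := Nat.div_add_mod c N
      have h4 := Nat.div_add_mod d N
      rw [mul_add]
      omega
    constructor
    · rw [e, Nat.mul_add_mod, Nat.mod_eq_of_lt hlt]
    · rw [e, Nat.mul_add_div hN, Nat.div_eq_of_lt hlt, add_zero]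
  refine ⟨Nat.mul_pos hN h'.one_le_size, .of_exists_unique (hsub h h') (hsub h.symm h'.symm) ?_ ?_ ?_⟩
  · rintro c ⟨hc, hc'⟩ d ⟨hd, hd'⟩
    have : (c + d) / N < N' := by
      rw [(hadd c d hc hd).2]
      exact h'.pair.add_mem hc' hd'
    rw [Nat.div_lt_iff_lt_mul hN, mul_comm] at this
    exact this
  · intro x hx
    obtain ⟨c, hc, d, hd, e⟩ := h.pair.exists_add (Set.mem_Iio.2 (Nat.mod_lt x hN))
    obtain ⟨c', hc', d', hd', e'⟩ := h'.pair.exists_add (c := x / N) (by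
      rw [Set.mem_Iio, Nat.div_lt_iff_lt_mul hN, mul_comm]
      exact hx)
    have hcN := h.lt hc
    have hdN := h.symm.lt hd
    refine ⟨N * c' + c, ⟨?_, ?_⟩, N * d' + d, ⟨?_, ?_⟩, ?_⟩
    · rwa [Nat.mul_add_mod, Nat.mod_eq_of_lt hcN]
    · rwa [Nat.mul_add_div hN, Nat.div_eq_of_lt hcN, add_zero]
    · rwa [Nat.mul_add_mod, Nat.mod_eq_of_lt hdN]
    · rwa [Nat.mul_add_div hN, Nat.div_eq_of_lt hdN, add_zero]
    · rw [← Nat.div_add_mod x N, ← e, ← e', mul_add]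
      omega
  · rintro a ⟨ha, ha'⟩ b ⟨hb, hb'⟩ c ⟨hc, hc'⟩ d ⟨hd, hd'⟩ e
    obtain ⟨h1, h2⟩ := hadd a c ha hc
    obtain ⟨h3, h4⟩ := hadd b d hb hd
    rw [e] at h1 h2
    obtain ⟨h5, h6⟩ := h.pair.eq_and_eq ha hb hc hd (h1.symm.trans h3)
    obtain ⟨h7, h8⟩ := h'.pair.eq_and_eq ha' hb' hc' hd' (h2.symm.trans h4)
    exact ⟨by rw [← Nat.div_add_mod a N, h5, h7, Nat.div_add_mod],
      by rw [← Nat.div_add_mod c N, h6, h8, Nat.div_add_mod]⟩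

theorem scaled_scaled {N' : ι → ℕ} : scaled N' (scaled N T) = scaled (N * N') T := by
  ext y
  simp only [mem_scaled, mul_assoc]

theorem Reduces.trans {N' : ι → ℕ} {C' D' : ι → Set ℕ} (h : Reduces T S N C D)
    (h' : Reduces (scaled N T) (scaled N S) N' C' D') :
    Reduces T S (N * N') (fun i => {c | c % N i ∈ C i ∧ c / N i ∈ C' i})
      (fun i => {c | c % N i ∈ D i ∧ c / N i ∈ D' i}) := by
  have hdiv : ∀ x : ι → ℕ, x / N / N' = x / (N * N') := fun x => by
    ext i
    exact Nat.div_div_eq_div_mul _ _ _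
  have hmod : ∀ (C C' : ι → Set ℕ) (x : ι → ℕ),
      (∀ i, x i % (N * N') i ∈ {c | c % N i ∈ C i ∧ c / N i ∈ C' i}) ↔
        (∀ i, x i % N i ∈ C i) ∧ ∀ i, (x / N) i % N' i ∈ C' i := by
    intro C C' x
    rw [← forall_and]
    refine forall_congr' fun i => ?_
    change x i % (N i * N' i) % N i ∈ C i ∧ x i % (N i * N' i) / N i ∈ C' i ↔
      x i % N i ∈ C i ∧ x i / N i % N' i ∈ C' i
    rw [Nat.mod_mul_right_mod, Nat.mod_mul_right_div_self]
  refine ⟨fun i => (h.interval i).mul (h'.interval i), fun x => ?_, fun x => ?_⟩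
  · rw [h.left, h'.left, hmod, hdiv, scaled_scaled, and_assoc]
  · rw [h.right, h'.right, hmod, hdiv, scaled_scaled, and_assoc]

variable [DecidableEq ι]

/-- The fibre lemma for `B = {i}`, with `a` the least positive multiple of the unit vector lying in
`S`. The corner is then the segment below `a`; it lies in `T`, as an `S`-part of one of its elements
would be a smaller multiple. -/
theorem IsNPair.exists_reduces_axis [Finite ι] (h : IsNPair T S) {i : ι} (h1 : Pi.single i 1 ∈ T)
    {m : ℕ} (hm : 0 < m) (hmS : Pi.single i m ∈ S) :
    ∃ (N : ι → ℕ) (C D : ι → Set ℕ), Reduces T S N C D ∧ 1 < N i ∧ ∀ j ≠ i, N j = 1 := by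
  obtain ⟨m, ⟨hm, hmS⟩, hmin⟩ : ∃ m, (0 < m ∧ (Pi.single i m : ι → ℕ) ∈ S) ∧
      ∀ k < m, ¬ (0 < k ∧ (Pi.single i k : ι → ℕ) ∈ S) := by
    classical
    exact ⟨_, Nat.find_spec (p := fun m => 0 < m ∧ (Pi.single i m : ι → ℕ) ∈ S) ⟨m, hm, hmS⟩,
      fun k => Nat.find_min _⟩
  have hm1 : 1 < m := by
    by_contra hc
    obtain rfl : m = 1 := by omega
    have := congrFun (h.eq_zero h1 hmS) i
    simp at this
  set a : ι → ℕ := Pi.single i m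
  have hB : ({i} : Set ι).Nonempty := ⟨i, rfl⟩
  have ha : ∀ j ∈ ({i} : Set ι), 0 < a j := by
    rintro j rfl
    simpa [a] using hm
  have ha0 : ∀ j ∉ ({i} : Set ι), a j = 0 := by
    intro j hj
    exact Pi.single_eq_of_ne hj _
  have hL : corner {i} a ⊆ T := by
    rintro l ⟨hl0, hl1⟩
    have hlm : l i < m := by simpa [a] using hl1
    obtain ⟨t, ht, s, hs, e⟩ := h.exists_add l
    have hs' : s = Pi.single i (s i) := by
      ext j
      by_cases hj : j = i
      · subst hj; simp
      · have h2 := congrFun e j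
        rw [hl0 j hj] at h2
        simp only [Pi.add_apply] at h2
        rw [Pi.single_eq_of_ne hj]
        omega
    have hsi : s i = 0 := by
      by_contra hc
      have h2 := congrFun e i
      simp only [Pi.add_apply] at h2
      exact hmin (s i) (by omega) ⟨by omega, hs' ▸ hs⟩
    rw [hsi, Pi.single_zero] at hs'
    rwa [← e, hs', add_zero]
  have key := h.mem_base_fibre hB ha ha0 hL hmS
  let N : ι → ℕ := Pi.mulSingle i m
  have hNi : N i = m := by simp [N]
  have hNj : ∀ j ≠ i, N j = 1 := fun j hj => by simp [N, hj]
  have hN1 : ∀ j, 1 ≤ N j := by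
    intro j
    by_cases hj : j = i
    · subst hj; omega
    · rw [hNj j hj]
  have hx : ∀ x : ι → ℕ, x = N * (x / N) + (fun j => x j % N j) := fun x => by
    ext j
    exact (Nat.div_add_mod (x j) (N j)).symm
  have hbase : ∀ x : ι → ℕ, IsBase {i} a (N * (x / N)) := by
    intro x
    refine ⟨x i / m, ?_⟩
    rintro j rfl
    simp [a, hNi, mul_comm]
  have hcor : ∀ x : ι → ℕ, (fun j => x j % N j) ∈ corner {i} a := by
    intro x
    refine ⟨fun j hj => ?_, fun hc => ?_⟩
    · simp [hNj j hj, Nat.mod_one]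
    · have h2 := hc i rfl
      have h3 := Nat.mod_lt (x i) hm
      simp only [a, Pi.single_eq_same, hNi] at h2
      omega
  refine ⟨N, fun j => Set.Iio (N j), fun _ => {0}, ⟨fun j => isIntervalPair_Iio (hN1 j), ?_, ?_⟩,
    by omega, hNj⟩
  · intro x
    rw [mem_scaled, ← (key _ (hbase x)).1 _ (hcor x), ← hx, and_iff_right]
    exact fun j => Nat.mod_lt _ (hN1 j)
  · intro x
    rw [mem_scaled]
    constructor
    · intro hxS
      rw [hx x] at hxS
      have h0 := (key _ (hbase x)).2 _ (hcor x) hxS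
      refine ⟨fun j => congrFun h0 j, ?_⟩
      rwa [h0, add_zero] at hxS
    · rintro ⟨h2, h3⟩
      have h0 : (fun j => x j % N j) = 0 := funext h2
      rw [hx x, h0, add_zero]
      exact h3

/-- On the face `ℕ^B`, the set `T` is the product of its intersections with the axes. -/
def IsAxisProduct (B : Set ι) (T : Set (ι → ℕ)) : Prop :=
  ∀ x, (∀ i ∉ B, x i = 0) → (x ∈ T ↔ ∀ i, Pi.single i (x i) ∈ T)

theorem Reduces.single_mem_iff (hr : Reduces T S N C D) (i : ι) (k : ℕ) :
    Pi.single i k ∈ T ↔ k % N i ∈ C i ∧ Pi.single i (k / N i) ∈ scaled N T := by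
  have h1 : (Pi.single i k : ι → ℕ) / N = Pi.single i (k / N i) := by
    ext j
    by_cases hj : j = i
    · subst hj; simp
    · simp [hj]
  rw [hr.left, h1]
  refine and_congr_left fun _ => ⟨fun h => by simpa using h i, fun h j => ?_⟩
  by_cases hj : j = i
  · subst hj; simpa using h
  · simpa [hj] using (hr.interval j).zero_mem

/-- Residue conditions are coordinatewise, so reductions neither create nor destroy axis products;
`IsAxisProduct.scaled` is the other direction. -/
theorem Reduces.isAxisProduct (hr : Reduces T S N C D) {B : Set ι}
    (h : IsAxisProduct B (scaled N T)) : IsAxisProduct B T := by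
  intro x hx
  rw [hr.left, h _ (fun i hi => by simp [hx i hi]), ← forall_and]
  exact forall_congr' fun i => (hr.single_mem_iff i (x i)).symm

theorem IsAxisProduct.scaled {B : Set ι} (h : IsAxisProduct B T) (N : ι → ℕ) :
    IsAxisProduct B (scaled N T) := by
  intro x hx
  rw [mem_scaled, h _ (fun i hi => by simp [hx i hi])]
  refine forall_congr' fun i => ?_
  rw [mem_scaled]
  have : N * Pi.single i (x i) = Pi.single i ((N * x) i) := by
    ext j
    by_cases hj : j = i
    · subst hj; simp
    · simp [hj]
  rw [this]

/-- Below `N i` the coordinate `x i` is merely a residue, independent of the other coordinates.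
Hence reductions of unbounded size at `i` would make `i` split off. -/
theorem Reduces.mem_iff_of_lt (hr : Reduces T S N C D) (h0 : 0 ∈ T) {x : ι → ℕ} {i : ι}
    (hlt : x i < N i) :
    x ∈ T ↔ Set.indicator {i} x ∈ T ∧ Set.indicator {i}ᶜ x ∈ T := by
  have h1 : Set.indicator {i} x / N = 0 := by
    ext j
    by_cases hj : j = i
    · subst hj; simp [Nat.div_eq_of_lt hlt]
    · simp [hj]
  have h2 : Set.indicator {i}ᶜ x / N = x / N := by
    ext j
    by_cases hj : j = i
    · subst hj; simp [Nat.div_eq_of_lt hlt]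
    · simp [hj]
  have h3 : (0 : ι → ℕ) ∈ NPair.scaled N T := by rwa [mem_scaled, mul_zero]
  have hz := fun j => (hr.interval j).zero_mem
  rw [hr.left x, hr.left (Set.indicator {i} x), hr.left (Set.indicator {i}ᶜ x), h1, h2,
    and_iff_left h3, ← and_assoc, ← forall_and]
  refine and_congr_left fun _ => forall_congr' fun j => ?_
  by_cases hj : j = i
  · subst hj; simpa using fun _ => hz _
  · simpa [hj] using fun _ => hz j

/-- Unless the pair splits off a coordinate of `B`, first type reductions along the coordinates
of `B` lead to a pair whose axes in `B` lie entirely in one of its two members. -/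
theorem IsNPair.exists_reduces_pure [Finite ι] (h : IsNPair T S) (B : Set ι)
    (hB : ∀ i ∈ B, ¬ (SplitsAt {i} T ∧ SplitsAt {i} S)) :
    ∃ (N : ι → ℕ) (C D : ι → Set ℕ), Reduces T S N C D ∧ (∀ i ∉ B, N i = 1) ∧
      ∀ i ∈ B, (∀ k, Pi.single i k ∈ scaled N T) ∨ ∀ k, Pi.single i k ∈ scaled N S := by
  classical
  have := Fintype.ofFinite ι
  -- If the sizes at `i` were unbounded, every `x` would satisfy `x i < N i` for some reduction, and
  -- `{i}` would split off.
  have hbdd : ∀ i, ∃ M, ∀ (N : ι → ℕ) (C D : ι → Set ℕ), Reduces T S N C D →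
      (∀ i ∉ B, N i = 1) → N i ≤ M := by
    intro i
    by_cases hi : i ∈ B
    · by_contra! hc
      refine hB i hi ⟨fun x => ?_, fun x => ?_⟩
      · obtain ⟨N, C, D, hr, -, hlt⟩ := hc (x i)
        exact hr.mem_iff_of_lt h.zero_mem hlt
      · obtain ⟨N, C, D, hr, -, hlt⟩ := hc (x i)
        exact hr.symm.mem_iff_of_lt h.symm.zero_mem hlt
    · exact ⟨1, fun N C D _ hN => (hN i hi).le⟩
  choose M hM using hbdd
  let K : Set ℕ := {k | ∃ (N : ι → ℕ) (C D : ι → Set ℕ), Reduces T S N C D ∧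
    (∀ i ∉ B, N i = 1) ∧ ∑ i, N i = k}
  have hK : BddAbove K := by
    refine ⟨∑ i, M i, ?_⟩
    rintro k ⟨N, C, D, hr, hN, rfl⟩
    exact Finset.sum_le_sum fun i _ => hM i N C D hr hN
  obtain ⟨N, C, D, hr, hN, hsum⟩ : sSup K ∈ K :=
    Nat.sSup_mem ⟨_, 1, _, _, reduces_one, fun _ _ => rfl, rfl⟩ hK
  -- A further proper reduction along a coordinate of `B` would increase the maximal sum of sizes.
  have hmax : ∀ i ∈ B, ∀ (N' : ι → ℕ) (C' D' : ι → Set ℕ),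
      Reduces (scaled N T) (scaled N S) N' C' D' → 1 < N' i → (∀ j ≠ i, N' j = 1) → False := by
    intro i hi N' C' D' hr' h1 hj
    have hle : ∑ j, (N * N') j ≤ sSup K := by
      refine le_csSup hK ⟨_, _, _, hr.trans hr', fun j hj' => ?_, rfl⟩
      have hji : j ≠ i := fun e => hj' (e ▸ hi)
      simp [hN j hj', hj j hji]
    rw [← hsum] at hle
    refine absurd hle (not_le_of_gt (Finset.sum_lt_sum (fun j _ => ?_) ⟨i, Finset.mem_univ i, ?_⟩))
    · exact Nat.le_mul_of_pos_right _ (hr'.interval j).one_le_size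
    · have := (hr.interval i).one_le_size
      simp only [Pi.mul_apply]
      nlinarith
  have hp := hr.isNPair h
  have hpure : ∀ {T' S' : Set (ι → ℕ)}, IsNPair T' S' → ∀ i,
      (∀ m, 0 < m → Pi.single i m ∉ S') → ∀ k, Pi.single i k ∈ T' := by
    intro T' S' hp i hm k
    obtain ⟨t, ht, s, hs, e⟩ := hp.exists_add (Pi.single i k)
    have hs' : s = Pi.single i (s i) := by
      ext j
      by_cases hj : j = i
      · subst hj; simp
      · have h2 := congrFun e j
        simp only [Pi.add_apply, Pi.single_eq_of_ne hj] at h2 ⊢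
        omega
    have hsi : s i = 0 := by
      by_contra hc
      exact hm (s i) (by omega) (hs' ▸ hs)
    rw [hsi, Pi.single_zero] at hs'
    rwa [← e, hs', add_zero]
  refine ⟨N, C, D, hr, hN, fun i hi => ?_⟩
  by_contra! hc
  obtain ⟨⟨k, hk⟩, k', hk'⟩ := hc
  have hS : ∃ m, 0 < m ∧ Pi.single i m ∈ scaled N S := by
    by_contra! hm
    exact hk (hpure hp i hm k)
  have hT : ∃ m, 0 < m ∧ Pi.single i m ∈ scaled N T := by
    by_contra! hm
    exact hk' (hpure hp.symm i hm k')
  obtain ⟨m, hm, hmS⟩ := hS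
  obtain ⟨m', hm', hmT⟩ := hT
  -- The unit vector lies in one member, while the other member contains some positive multiple of
  -- it, so a further reduction exists.
  obtain ⟨t, ht, s, hs, e⟩ := hp.exists_add (Pi.single i 1)
  have hoff : ∀ j ≠ i, t j = 0 ∧ s j = 0 := by
    intro j hj
    have h2 := congrFun e j
    simp only [Pi.add_apply, Pi.single_eq_of_ne hj] at h2
    omega
  have hi1 : t i + s i = 1 := by simpa using congrFun e i
  by_cases hti : t i = 0
  · have hs1 : s = Pi.single i 1 := by
      ext j
      by_cases hj : j = i
      · subst hj
        rw [Pi.single_eq_same]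
        omega
      · rw [Pi.single_eq_of_ne hj, (hoff j hj).2]
    obtain ⟨N', C', D', hr', h1, hj⟩ := hp.symm.exists_reduces_axis (hs1 ▸ hs) hm' hmT
    exact hmax i hi N' _ _ hr'.symm h1 hj
  · have ht1 : t = Pi.single i 1 := by
      ext j
      by_cases hj : j = i
      · subst hj
        rw [Pi.single_eq_same]
        omega
      · rw [Pi.single_eq_of_ne hj, (hoff j hj).1]
    obtain ⟨N', C', D', hr', h1, hj⟩ := hp.exists_reduces_axis (ht1 ▸ ht) hm hmS
    exact hmax i hi N' _ _ hr' h1 hj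

end Reduction

/-! ### Finding the corner `L_a` -/

section Corner

variable {ι : Type*} {T S : Set (ι → ℕ)} {B : Set ι}

/-- On this face the decomposition of `x` is the sum of its restrictions to `P` and `Q`, so `x ∈ T`
exactly when the restriction to `Q` vanishes. -/
theorem IsNPair.isAxisProduct_of_union [DecidableEq ι] (h : IsNPair T S) {P Q : Set ι}
    (hPQ : Disjoint P Q) (hP : ∀ x, (∀ i ∉ P, x i = 0) → x ∈ T)
    (hQ : ∀ x, (∀ i ∉ Q, x i = 0) → x ∈ S) : IsAxisProduct (P ∪ Q) T := by
  intro x hx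
  have hsum : P.indicator x + Q.indicator x = x := by
    refine (Set.indicator_union_of_disjoint hPQ x).symm.trans (Set.indicator_eq_self.2 ?_)
    intro i hi
    by_contra hc
    exact hi (hx i hc)
  have hPx : P.indicator x ∈ T := hP _ fun i hi => Set.indicator_of_notMem hi x
  have hQx : Q.indicator x ∈ S := hQ _ fun i hi => Set.indicator_of_notMem hi x
  have h1 : x ∈ T ↔ Q.indicator x = 0 := by
    constructor
    · intro hxT
      exact (h.eq_and_eq hPx hxT hQx h.symm.zero_mem (by rw [hsum, add_zero])).2
    · intro h0
      rw [h0, add_zero] at hsum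
      rwa [← hsum]
  rw [h1]
  constructor
  · intro h0 i
    by_cases hi : i ∈ P
    · refine hP _ fun j hj => Pi.single_eq_of_ne ?_ _
      rintro rfl
      exact hj hi
    · have : x i = 0 := by
        have h2 := congrFun hsum i
        rw [← h2, h0]
        simp [hi]
      rw [this, Pi.single_zero]
      exact h.zero_mem
  · intro h0
    ext i
    by_cases hi : i ∈ Q
    · have hS : (Pi.single i (x i) : ι → ℕ) ∈ S := by
        refine hQ _ fun j hj => Pi.single_eq_of_ne ?_ _
        rintro rfl
        exact hj hi
      have := congrFun (h.eq_zero (h0 i) hS) i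
      simpa [hi] using this
    · simp [hi]

/-- By minimality of `B` every proper face of `ℕ^B` lies in `T`. The vector `a` is a minimal nonzero
element of `S` on `ℕ^B`; its coordinates in `B` are positive, since otherwise it would lie in `T` as
well. -/
theorem IsNPair.exists_corner_of_axes_subset [Finite ι] [DecidableEq ι] (h : IsNPair T S)
    (hB : ¬ (IsAxisProduct B T ∧ IsAxisProduct B S))
    (hmin : ∀ B' ⊂ B, IsAxisProduct B' T ∧ IsAxisProduct B' S)
    (hT : ∀ i ∈ B, ∀ k, Pi.single i k ∈ T) :
    ∃ a, (∀ i ∈ B, 0 < a i) ∧ (∀ i ∉ B, a i = 0) ∧ corner B a ⊆ T ∧ a ∈ S := by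
  have hface : ∀ x : ι → ℕ, (∀ i ∉ B, x i = 0) → (∃ i ∈ B, x i = 0) → x ∈ T := by
    rintro x hx ⟨j, hj, hxj⟩
    refine ((hmin (B \ {j}) ⟨Set.sdiff_subset, fun hc => (hc hj).2 rfl⟩).1 x fun i hi => ?_).2
      fun i => ?_
    · by_cases hij : i = j
      · rwa [hij]
      · exact hx i fun hiB => hi ⟨hiB, hij⟩
    · by_cases hi : i ∈ B
      · exact hT i hi _
      · rw [hx i hi, Pi.single_zero]
        exact h.zero_mem
  -- Otherwise `ℕ^B ⊆ T`, and `IsNPair.isAxisProduct_of_union` with `P = B`, `Q = ∅` contradicts the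
  -- choice of `B`.
  have hex : ∃ a ∈ S, (∀ i ∉ B, a i = 0) ∧ a ≠ 0 := by
    by_contra! hc
    refine hB (Set.union_empty B ▸ ⟨?_, ?_⟩)
    · refine h.isAxisProduct_of_union (Set.disjoint_empty B) (fun x hx => ?_) fun x hx => ?_
      · obtain ⟨t, ht, s, hs, e⟩ := h.exists_add x
        have : s = 0 := by
          refine hc s hs fun i hi => ?_
          have h1 := congrFun e i
          rw [hx i hi] at h1
          simp only [Pi.add_apply] at h1
          omega
        rwa [← e, this, add_zero]
      · rw [show x = 0 from funext fun i => hx i (Set.notMem_empty i)]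
        exact h.symm.zero_mem
    · rw [Set.union_comm]
      refine h.symm.isAxisProduct_of_union (Set.disjoint_empty B).symm (fun x hx => ?_)
        fun x hx => ?_
      · rw [show x = 0 from funext fun i => hx i (Set.notMem_empty i)]
        exact h.symm.zero_mem
      · obtain ⟨t, ht, s, hs, e⟩ := h.exists_add x
        have : s = 0 := by
          refine hc s hs fun i hi => ?_
          have h1 := congrFun e i
          rw [hx i hi] at h1
          simp only [Pi.add_apply] at h1
          omega
        rwa [← e, this, add_zero]
  obtain ⟨a, ⟨haS, ha0, hane⟩, hamin⟩ :=
    wellFounded_lt.has_min {a : ι → ℕ | a ∈ S ∧ (∀ i ∉ B, a i = 0) ∧ a ≠ 0} hex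
  have hpos : ∀ s ∈ S, (∀ i ∉ B, s i = 0) → s ≠ 0 → ∀ i ∈ B, 0 < s i := by
    intro s hs hs0 hsne i hi
    by_contra hc
    exact hsne (h.eq_zero (hface s hs0 ⟨i, hi, by omega⟩) hs)
  refine ⟨a, hpos a haS ha0 hane, ha0, fun l hl => ?_, haS⟩
  obtain ⟨t, ht, s, hs, e⟩ := h.exists_add l
  have hsl : s ≤ l := by rw [← e]; exact le_add_self
  have hs0 : ∀ i ∉ B, s i = 0 := fun i hi => Nat.le_zero.1 ((hsl i).trans (hl.1 i hi).le)
  by_cases hsz : s = 0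
  · rwa [← e, hsz, add_zero]
  exfalso
  have hsa : ¬ a ≤ s := fun hc => hl.2 fun i _ => (hc i).trans (hsl i)
  have hsa' : ¬ s ≤ a := fun hc =>
    hamin s ⟨hs, hs0, hsz⟩ (lt_of_le_of_ne hc fun e' => hsa e'.ge)
  have hex' : ∀ u v : ι → ℕ, (∀ i ∉ B, u i = 0) → ¬ u ≤ v → ∃ i ∈ B, v i - u i = 0 := by
    intro u v hu huv
    rw [Pi.le_def, not_forall] at huv
    obtain ⟨i, hi⟩ := huv
    refine ⟨i, by_contra fun hc => hi (by rw [hu i hc]; exact Nat.zero_le _), by omega⟩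
  -- As `s` and `a` are incomparable, both truncated differences vanish somewhere in `B` and so lie
  -- in `T`. Then `(s - a) + a` and `(a - s) + s` are two decompositions of `max a s`.
  have h1 : s - a ∈ T := hface _ (fun i hi => by simp [hs0 i hi]) (hex' a s ha0 hsa)
  have h2 : a - s ∈ T := hface _ (fun i hi => by simp [ha0 i hi]) (hex' s a hs0 hsa')
  have h3 := (h.eq_and_eq h1 h2 haS hs (by
    ext i
    simp only [Pi.add_apply, Pi.sub_apply]
    omega)).2
  exact hsa h3.le

/-- If axes of both kinds occurred, with index sets `P` and `Q`, minimality would give `ℕ^P ⊆ T` and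
`ℕ^Q ⊆ S`, making both members axis products on `B`. -/
theorem IsNPair.exists_corner [Finite ι] [DecidableEq ι] (h : IsNPair T S)
    (hB : ¬ (IsAxisProduct B T ∧ IsAxisProduct B S))
    (hmin : ∀ B' ⊂ B, IsAxisProduct B' T ∧ IsAxisProduct B' S)
    (hpure : ∀ i ∈ B, (∀ k, Pi.single i k ∈ T) ∨ ∀ k, Pi.single i k ∈ S) :
    ∃ a, (∀ i ∈ B, 0 < a i) ∧ (∀ i ∉ B, a i = 0) ∧
      (corner B a ⊆ T ∧ a ∈ S ∨ corner B a ⊆ S ∧ a ∈ T) := by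
  let P : Set ι := {i | i ∈ B ∧ ∀ k, Pi.single i k ∈ T}
  let Q : Set ι := {i | i ∈ B ∧ ¬ ∀ k, Pi.single i k ∈ T}
  by_cases hQ : Q.Nonempty
  · by_cases hP : P.Nonempty
    · exfalso
      obtain ⟨p, hp⟩ := hP
      obtain ⟨q, hq⟩ := hQ
      have hPB : P ⊂ B := ⟨fun i hi => hi.1, fun hc => hq.2 (hc hq.1).2⟩
      have hQB : Q ⊂ B := ⟨fun i hi => hi.1, fun hc => (hc hp.1).2 hp.2⟩
      have hU : P ∪ Q = B := by
        ext i
        by_cases hi : ∀ k, (Pi.single i k : ι → ℕ) ∈ T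
        · simp [P, Q, hi]
        · exact ⟨fun hi => hi.elim (fun h => h.1) fun h => h.1, fun hiB => Or.inr ⟨hiB, hi⟩⟩
      have hd : Disjoint P Q := Set.disjoint_left.2 fun i h1 h2 => h2.2 h1.2
      have hPT : ∀ x : ι → ℕ, (∀ i ∉ P, x i = 0) → x ∈ T := by
        intro x hx
        refine ((hmin P hPB).1 x hx).2 fun i => ?_
        by_cases hi : i ∈ P
        · exact hi.2 _
        · rw [hx i hi, Pi.single_zero]
          exact h.zero_mem
      have hQS : ∀ x : ι → ℕ, (∀ i ∉ Q, x i = 0) → x ∈ S := by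
        intro x hx
        refine ((hmin Q hQB).2 x hx).2 fun i => ?_
        by_cases hi : i ∈ Q
        · exact (hpure i hi.1).resolve_left hi.2 _
        · rw [hx i hi, Pi.single_zero]
          exact h.symm.zero_mem
      refine hB ⟨hU ▸ h.isAxisProduct_of_union hd hPT hQS, ?_⟩
      rw [← hU, Set.union_comm]
      exact h.symm.isAxisProduct_of_union hd.symm hQS hPT
    · obtain ⟨a, h1, h2, h3⟩ := h.symm.exists_corner_of_axes_subset (fun hc => hB hc.symm)
        (fun B' hB' => (hmin B' hB').symm) fun i hi =>
          (hpure i hi).resolve_left fun hc => hP ⟨i, hi, hc⟩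
      exact ⟨a, h1, h2, Or.inr h3⟩
  · obtain ⟨a, h1, h2, h3⟩ := h.exists_corner_of_axes_subset hB hmin fun i hi =>
      by_contra fun hc => hQ ⟨i, hi, hc⟩
    exact ⟨a, h1, h2, Or.inl h3⟩

/-- If both members were axis products in all variables, each variable would split off; so a minimal
bad `B` exists. Sets with at most one variable are never bad. -/
theorem exists_minimal_not_isAxisProduct [Finite ι] [DecidableEq ι] [Nontrivial ι]
    (h : IsPrimitiveNPair T S) :
    ∃ B : Set ι, B.Nontrivial ∧ ¬ (IsAxisProduct B T ∧ IsAxisProduct B S) ∧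
      (∀ B' ⊂ B, IsAxisProduct B' T ∧ IsAxisProduct B' S) ∧
      ∀ i ∈ B, ¬ (SplitsAt {i} T ∧ SplitsAt {i} S) := by
  obtain ⟨hp, hc⟩ := h
  rw [hp.isCartesianProduct_iff] at hc
  obtain ⟨p, q, hpq⟩ := exists_pair_ne ι
  have hsplit : ∀ i, ¬ (SplitsAt {i} T ∧ SplitsAt {i} S) := by
    rintro i hi
    refine hc ⟨{i}, ⟨i, rfl⟩, ?_, hi⟩
    by_cases hip : i = p
    · exact ⟨q, fun hq => hpq (hip.symm.trans hq.symm)⟩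
    · exact ⟨p, fun hq => hip hq.symm⟩
  have hax : ∀ (R : Set (ι → ℕ)) (i : ι), 0 ∈ R → IsAxisProduct Set.univ R →
      SplitsAt {i} R := by
    intro R i h0 hR x
    rw [hR x (by simp), hR (Set.indicator {i} x) (by simp), hR (Set.indicator {i}ᶜ x) (by simp),
      ← forall_and]
    refine forall_congr' fun k => ?_
    by_cases hk : k = i
    · subst hk; simpa using fun _ => h0
    · simpa [hk] using fun _ => h0
  have huniv : ¬ (IsAxisProduct Set.univ T ∧ IsAxisProduct Set.univ S) := fun ⟨h1, h2⟩ =>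
    hsplit p ⟨hax T p hp.zero_mem h1, hax S p hp.symm.zero_mem h2⟩
  obtain ⟨B, hB, hmin⟩ := wellFounded_lt.has_min
    {B : Set ι | ¬ (IsAxisProduct B T ∧ IsAxisProduct B S)} ⟨_, huniv⟩
  refine ⟨B, ?_, hB, fun B' hB' => by_contra fun hc => hmin B' hc hB', fun i _ => hsplit i⟩
  by_contra hnt
  rw [Set.not_nontrivial_iff] at hnt
  have hone : ∀ R : Set (ι → ℕ), 0 ∈ R → IsAxisProduct B R := by
    intro R h0 x hx
    rcases hnt.eq_empty_or_singleton with rfl | ⟨i, rfl⟩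
    · have : x = 0 := funext fun i => hx i (Set.notMem_empty i)
      subst this
      simp [h0]
    · have hxi : x = Pi.single i (x i) := by
        ext j
        by_cases hj : j = i
        · subst hj; simp
        · rw [Pi.single_eq_of_ne hj]
          exact hx j hj
      constructor
      · intro hxR j
        by_cases hj : j = i
        · subst hj
          rwa [← hxi]
        · rw [hx j hj, Pi.single_zero]
          exact h0
      · intro hj
        rw [hxi]
        exact hj i
  exact hB ⟨hone T hp.zero_mem, hone S hp.symm.zero_mem⟩

end Corner

/-! ### Contracting `B` to one variable -/

section Contract

variable {ι : Type*} {T S : Set (ι → ℕ)} {B : Set ι} {a N : ι → ℕ} {C D : ι → Set ℕ}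

open Classical in
/-- The coordinates in `B` are contracted to a single new coordinate `none`. -/
noncomputable def contract (B : Set ι) (i : ι) : Option {i // i ∉ B} :=
  if h : i ∈ B then none else some ⟨i, h⟩

theorem contract_mem {i : ι} (h : i ∈ B) : contract B i = none := by simp [contract, h]

theorem contract_notMem {i : ι} (h : i ∉ B) : contract B i = some ⟨i, h⟩ := by simp [contract, h]

open Classical in
/-- The effect on exponent vectors of substituting `∏_{i ∈ B} x_i ^ a i` for the variable
`none`. -/
noncomputable def substVec (B : Set ι) (a : ι → ℕ) (t : Option {i // i ∉ B} → ℕ) : ι → ℕ :=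
  fun i => t (contract B i) * if i ∈ B then a i else 1

theorem substVec_mem (t : Option {i // i ∉ B} → ℕ) {i : ι} (h : i ∈ B) :
    substVec B a t i = t none * a i := by simp [substVec, contract_mem h, h]

theorem substVec_notMem (t : Option {i // i ∉ B} → ℕ) {i : ι} (h : i ∉ B) :
    substVec B a t i = t (some ⟨i, h⟩) := by simp [substVec, contract_notMem h, h]

theorem substVec_add (t t' : Option {i // i ∉ B} → ℕ) :
    substVec B a (t + t') = substVec B a t + substVec B a t' := by
  ext i
  by_cases hi : i ∈ B <;> simp [substVec, hi, add_mul]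

theorem isBase_substVec (t : Option {i // i ∉ B} → ℕ) : IsBase B a (substVec B a t) :=
  ⟨t none, fun _ hi => substVec_mem t hi⟩

theorem IsBase.exists_substVec {b : ι → ℕ} (hb : IsBase B a b) : ∃ t, substVec B a t = b := by
  obtain ⟨k, hk⟩ := hb
  refine ⟨fun o => o.elim k fun i => b i, ?_⟩
  ext i
  by_cases hi : i ∈ B
  · rw [substVec_mem _ hi, hk i hi]
    rfl
  · rw [substVec_notMem _ hi]
    rfl

theorem substVec_injective (hB : B.Nonempty) (ha : ∀ i ∈ B, 0 < a i) :
    Function.Injective (substVec B a) := by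
  intro t t' e
  ext (_ | ⟨i, hi⟩)
  · obtain ⟨j, hj⟩ := hB
    have := congrFun e j
    rw [substVec_mem _ hj, substVec_mem _ hj] at this
    exact Nat.eq_of_mul_eq_mul_right (ha j hj) this
  · have := congrFun e i
    rwa [substVec_notMem _ hi, substVec_notMem _ hi] at this

theorem substVec_indicator (s : Set (Option {i // i ∉ B})) (t : Option {i // i ∉ B} → ℕ) :
    substVec B a (s.indicator t) = (contract B ⁻¹' s).indicator (substVec B a t) := by
  ext i
  by_cases hi : contract B i ∈ s <;> simp [substVec, hi]

/-- The set `L_a` (for `ε = 1`) or `{0}` (for `ε = 0`). -/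
def cornerOrZero (B : Set ι) (a : ι → ℕ) (ε : Fin 2) : Set (ι → ℕ) :=
  if ε = 1 then corner B a else {0}

/-- The extension of `R` which replaces the variable `none` by the variables in `B`. -/
def extendVec (B : Set ι) (C : ι → Set ℕ) (a N : ι → ℕ) (ε : Fin 2)
    (R : Set (Option {i // i ∉ B} → ℕ)) : Set (ι → ℕ) :=
  {x | ∃ c : ι → ℕ, (∀ i ∈ B, c i ∈ C i) ∧ ∃ l ∈ cornerOrZero B a ε, ∃ t ∈ R,
    (∀ i ∈ B, x i = c i + N i * l i + t none * (a i * N i)) ∧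
    ∀ i (h : i ∉ B), x i = t (some ⟨i, h⟩)}

theorem eq_zero_of_mem_cornerOrZero {ε : Fin 2} {l : ι → ℕ} (hl : l ∈ cornerOrZero B a ε) {i : ι}
    (hi : i ∉ B) : l i = 0 := by
  rw [cornerOrZero] at hl
  split_ifs at hl
  · exact hl.1 i hi
  · rw [Set.mem_singleton_iff.1 hl]
    rfl

/-- This separates the lowest digits of `x` from the quotient `x / N`. Outside `B` the size is `1`,
so the digit there is `0` and imposes no condition. -/
theorem mem_extendVec_iff (hC : ∀ i, IsIntervalPair (N i) (C i) (D i)) (hN : ∀ i ∉ B, N i = 1)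
    {ε : Fin 2} {R : Set (Option {i // i ∉ B} → ℕ)} {x : ι → ℕ} :
    x ∈ extendVec B C a N ε R ↔ (∀ i, x i % N i ∈ C i) ∧
      ∃ l ∈ cornerOrZero B a ε, ∃ t ∈ R, substVec B a t + l = x / N := by
  constructor
  · rintro ⟨c, hc, l, hl, t, ht, h1, h2⟩
    have hx : ∀ i ∈ B, x i = N i * (l i + t none * a i) + c i := by
      intro i hi
      rw [h1 i hi]
      ring
    refine ⟨fun i => ?_, l, hl, t, ht, ?_⟩
    · by_cases hi : i ∈ B
      · rw [hx i hi, Nat.mul_add_mod, Nat.mod_eq_of_lt ((hC i).lt (hc i hi))]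
        exact hc i hi
      · rw [hN i hi, Nat.mod_one]
        exact (hC i).zero_mem
    · ext i
      by_cases hi : i ∈ B
      · rw [Pi.add_apply, Pi.div_apply, hx i hi, Nat.mul_add_div (hC i).one_le_size,
          Nat.div_eq_of_lt ((hC i).lt (hc i hi)), substVec_mem _ hi]
        ring
      · rw [Pi.add_apply, Pi.div_apply, hN i hi, Nat.div_one, substVec_notMem _ hi,
          eq_zero_of_mem_cornerOrZero hl hi, add_zero, h2 i hi]
  · rintro ⟨hc, l, hl, t, ht, e⟩
    refine ⟨fun i => x i % N i, fun i _ => hc i, l, hl, t, ht, fun i hi => ?_, fun i hi => ?_⟩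
    · have h1 := congrFun e i
      have h2 := Nat.div_add_mod (x i) (N i)
      rw [Pi.add_apply, Pi.div_apply, substVec_mem _ hi] at h1
      rw [← h1] at h2
      refine h2.symm.trans ?_
      ring
    · have h1 := congrFun e i
      rw [Pi.add_apply, Pi.div_apply, hN i hi, Nat.div_one, substVec_notMem _ hi,
        eq_zero_of_mem_cornerOrZero hl hi, add_zero] at h1
      exact h1.symm

theorem Reduces.splitsAt (hr : Reduces T S N C D) {s : Set ι} (h : SplitsAt s (scaled N T)) :
    SplitsAt s T := by
  intro x
  have hd : ∀ s : Set ι, s.indicator x / N = s.indicator (x / N) := by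
    intro s
    ext i
    by_cases hi : i ∈ s <;> simp [hi]
  rw [hr.left x, hr.left (s.indicator x), hr.left (sᶜ.indicator x), h (x / N), hd, hd,
    and_and_and_comm, ← forall_and]
  refine and_congr_left fun _ => forall_congr' fun i => ?_
  have hz := (hr.interval i).zero_mem
  by_cases hi : i ∈ s <;> simp [hi, hz]

/-- By the fibre lemma the `S`-part of a base vector is a base vector, hence so is the difference,
which is the `T`-part. -/
theorem IsNPair.contract [Finite ι] (h : IsNPair T S) (hB : B.Nonempty) (ha : ∀ i ∈ B, 0 < a i)
    (ha0 : ∀ i ∉ B, a i = 0) (hL : corner B a ⊆ T) (haS : a ∈ S) :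
    IsNPair (substVec B a ⁻¹' T) (substVec B a ⁻¹' S) := by
  have key := h.mem_base_fibre hB ha ha0 hL haS
  refine IsPairOf.of_exists_unique (Set.subset_univ _) (Set.subset_univ _)
    (fun _ _ _ _ => Set.mem_univ _) ?_ ?_
  · intro c _
    obtain ⟨t, ht, s, hs, e⟩ := h.exists_add (substVec B a c)
    have hsb : IsBase B a s := by
      obtain ⟨b, l, hb, hl, rfl⟩ := exists_isBase_add_corner hB ha s
      rwa [(key b hb).2 l hl hs, add_zero]
    have htb : IsBase B a t := by
      have : t = substVec B a c - s := by rw [← e, add_tsub_cancel_right]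
      rw [this]
      exact (isBase_substVec c).sub hsb
    obtain ⟨s', rfl⟩ := hsb.exists_substVec
    obtain ⟨t', rfl⟩ := htb.exists_substVec
    refine ⟨t', ht, s', hs, substVec_injective hB ha ?_⟩
    rw [substVec_add, e]
  · intro t ht t' ht' s hs s' hs' e
    have := h.eq_and_eq ht ht' hs hs' (by rw [← substVec_add, ← substVec_add, e])
    exact ⟨substVec_injective hB ha this.1, substVec_injective hB ha this.2⟩

/-- The corner part of a vector is supported in `B`, so it goes entirely to the side containing
`none`, where the fibre lemma shows that it is harmless. -/
theorem IsNPair.splitsAt_of_contract [Finite ι] (h : IsNPair T S) (hB : B.Nonempty)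
    (ha : ∀ i ∈ B, 0 < a i) (ha0 : ∀ i ∉ B, a i = 0) (hL : corner B a ⊆ T) (haS : a ∈ S)
    {s : Set (Option {i // i ∉ B})} (hs : none ∈ s) :
    (SplitsAt s (substVec B a ⁻¹' T) → SplitsAt (NPair.contract B ⁻¹' s) T) ∧
      (SplitsAt s (substVec B a ⁻¹' S) → SplitsAt (NPair.contract B ⁻¹' s) S) := by
  have key := h.mem_base_fibre hB ha ha0 hL haS
  have hdec : ∀ x : ι → ℕ, ∃ t, ∃ l ∈ corner B a, x = substVec B a t + l ∧
      (NPair.contract B ⁻¹' s).indicator x = substVec B a (s.indicator t) + l ∧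
      (NPair.contract B ⁻¹' s)ᶜ.indicator x = substVec B a (sᶜ.indicator t) := by
    intro x
    obtain ⟨b, l, hb, hl, rfl⟩ := exists_isBase_add_corner hB ha x
    obtain ⟨t, rfl⟩ := hb.exists_substVec
    have hsB : ∀ i ∉ NPair.contract B ⁻¹' s, l i = 0 := by
      intro i hi
      refine hl.1 i fun hiB => hi ?_
      rwa [Set.mem_preimage, contract_mem hiB]
    refine ⟨t, l, hl, rfl, ?_, ?_⟩
    · rw [substVec_indicator]
      ext i
      by_cases hi : i ∈ NPair.contract B ⁻¹' s
      · simp only [Set.indicator_of_mem hi, Pi.add_apply]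
      · simp only [Set.indicator_of_notMem hi, Pi.add_apply, hsB i hi, add_zero]
    · rw [substVec_indicator, Set.preimage_compl]
      ext i
      by_cases hi : i ∈ NPair.contract B ⁻¹' s
      · have hi' : i ∉ (NPair.contract B ⁻¹' s)ᶜ := fun hc => hc hi
        simp only [Set.indicator_of_notMem hi']
      · have hi' : i ∈ (NPair.contract B ⁻¹' s)ᶜ := hi
        simp only [Set.indicator_of_mem hi', Pi.add_apply, hsB i hi, add_zero]
  constructor
  · intro hT x
    obtain ⟨t, l, hl, hx, h1, h2⟩ := hdec x
    rw [h1, h2, hx, (key _ (isBase_substVec t)).1 l hl, (key _ (isBase_substVec _)).1 l hl]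
    exact hT t
  · intro hS x
    obtain ⟨t, l, hl, hx, h1, h2⟩ := hdec x
    rw [h1, h2, hx]
    constructor
    · intro hm
      have h0 := (key _ (isBase_substVec t)).2 l hl hm
      rw [h0, add_zero] at hm ⊢
      exact (hS t).1 hm
    · rintro ⟨hm, hm'⟩
      have h0 := (key _ (isBase_substVec _)).2 l hl hm
      rw [h0, add_zero] at hm ⊢
      exact (hS t).2 ⟨hm, hm'⟩

theorem IsPrimitiveNPair.extendVec_of_corner_subset [Finite ι] (h : IsPrimitiveNPair T S)
    (hB : B.Nonempty) (hr : Reduces T S N C D) (hN : ∀ i ∉ B, N i = 1) (ha : ∀ i ∈ B, 0 < a i)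
    (ha0 : ∀ i ∉ B, a i = 0) (hL : corner B a ⊆ scaled N T) (haS : a ∈ scaled N S) :
    ∃ T' S' : Set (Option {i // i ∉ B} → ℕ), IsPrimitiveNPair T' S' ∧ (∃ s ∈ S', s ≠ 0) ∧
      T = extendVec B C a N 1 T' ∧ S = extendVec B D a N 0 S' := by
  have hp := hr.isNPair h.1
  have key := hp.mem_base_fibre hB ha ha0 hL haS
  have hc := hp.contract hB ha ha0 hL haS
  refine ⟨_, _, ⟨hc, ?_⟩, ?_, ?_, ?_⟩
  -- Complementing `s` if necessary, the contracted variable may be assumed to lie in `s`.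
  · have hno : ∀ s : Set (Option {i // i ∉ B}), none ∈ s → sᶜ.Nonempty →
        SplitsAt s (substVec B a ⁻¹' scaled N T) → SplitsAt s (substVec B a ⁻¹' scaled N S) →
        False := by
      rintro s hs ⟨o, ho⟩ hT hS
      have hsp := hp.splitsAt_of_contract hB ha ha0 hL haS hs
      refine h.2 (h.1.isCartesianProduct_iff.2 ⟨NPair.contract B ⁻¹' s, ?_, ?_,
        hr.splitsAt (hsp.1 hT), hr.symm.splitsAt (hsp.2 hS)⟩)
      · obtain ⟨j, hj⟩ := hB
        exact ⟨j, by rwa [Set.mem_preimage, contract_mem hj]⟩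
      · rcases o with _ | ⟨i, hi⟩
        · exact absurd hs ho
        · exact ⟨i, by rwa [Set.mem_compl_iff, Set.mem_preimage, contract_notMem hi]⟩
    rw [hc.isCartesianProduct_iff]
    rintro ⟨s, hs, hs', hT, hS⟩
    by_cases h0 : none ∈ s
    · exact hno s h0 hs' hT hS
    · exact hno sᶜ h0 (by rwa [compl_compl]) hT.compl hS.compl
  -- The vector `a ∈ S` is the base vector with multiplier `1`. It makes `S'` different from `{0}`,
  -- as the constraint on `δ` at the root demands.
  · have haB : IsBase B a a := ⟨1, fun i _ => by simp⟩
    obtain ⟨s, hs⟩ := haB.exists_substVec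
    refine ⟨s, by rwa [Set.mem_preimage, hs], ?_⟩
    rintro rfl
    obtain ⟨j, hj⟩ := hB
    have h1 := congrFun hs j
    have h2 := ha j hj
    rw [substVec_mem _ hj, Pi.zero_apply, zero_mul] at h1
    omega
  · ext x
    rw [mem_extendVec_iff hr.interval hN, hr.left]
    refine and_congr_right fun _ => ?_
    simp only [cornerOrZero, if_true]
    constructor
    · intro hx
      obtain ⟨b, l, hb, hl, e⟩ := exists_isBase_add_corner hB ha (x / N)
      rw [← e, (key b hb).1 l hl] at hx
      obtain ⟨t, rfl⟩ := hb.exists_substVec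
      exact ⟨l, hl, t, hx, e⟩
    · rintro ⟨l, hl, t, ht, e⟩
      rw [← e]
      exact ((key _ (isBase_substVec t)).1 l hl).2 ht
  · ext x
    rw [mem_extendVec_iff hr.symm.interval hN, hr.right]
    refine and_congr_right fun _ => ?_
    simp only [cornerOrZero, zero_ne_one, if_false]
    constructor
    · intro hx
      obtain ⟨b, l, hb, hl, e⟩ := exists_isBase_add_corner hB ha (x / N)
      rw [← e] at hx
      have h0 := (key b hb).2 l hl hx
      obtain ⟨t, rfl⟩ := hb.exists_substVec
      subst h0
      rw [add_zero] at hx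
      exact ⟨0, rfl, t, hx, e⟩
    · rintro ⟨l, rfl, t, ht, e⟩
      rw [← e, add_zero]
      exact ht

/-- Every primitive pair in at least two variables is an extension of a primitive pair in fewer
variables. -/
theorem IsPrimitiveNPair.exists_extendVec [Finite ι] [Nontrivial ι] (h : IsPrimitiveNPair T S) :
    ∃ (B : Set ι) (C D : ι → Set ℕ) (a N : ι → ℕ) (ε : Fin 2)
      (T' S' : Set (Option {i // i ∉ B} → ℕ)), B.Nontrivial ∧ (∀ i ∈ B, 0 < a i) ∧
      (∀ i, IsIntervalPair (N i) (C i) (D i)) ∧ IsPrimitiveNPair T' S' ∧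
      (T' = {0} → ε = 1) ∧ (S' = {0} → ε = 0) ∧
      T = extendVec B C a N ε T' ∧ S = extendVec B D a N (1 - ε) S' := by
  classical
  obtain ⟨B, hnt, hB, hmin, hsp⟩ := exists_minimal_not_isAxisProduct h
  obtain ⟨N, C, D, hr, hN, hpure⟩ := h.1.exists_reduces_pure B hsp
  -- Both the failure at `B` and the minimality of `B` survive the reduction.
  obtain ⟨a, ha, ha0, hor⟩ := (hr.isNPair h.1).exists_corner
    (fun hc => hB ⟨hr.isAxisProduct hc.1, hr.symm.isAxisProduct hc.2⟩)
    (fun B' hB' => ⟨(hmin B' hB').1.scaled N, (hmin B' hB').2.scaled N⟩) hpure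
  rcases hor with ⟨hL, haS⟩ | ⟨hL, haT⟩
  · obtain ⟨T', S', h', ⟨s, hs, hs0⟩, hT, hS⟩ :=
      h.extendVec_of_corner_subset hnt.nonempty hr hN ha ha0 hL haS
    refine ⟨B, C, D, a, N, 1, T', S', hnt, ha, hr.interval, h', fun _ => rfl, fun hc => ?_, hT, hS⟩
    rw [hc] at hs
    exact absurd hs hs0
  · have hsymm : ∀ {κ : Type _} {T S : Set (κ → ℕ)}, IsPrimitiveNPair T S →
        IsPrimitiveNPair S T := by
      intro κ T S h
      refine ⟨h.1.symm, ?_⟩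
      rw [h.1.symm.isCartesianProduct_iff]
      rintro ⟨s, h1, h2, h3, h4⟩
      exact h.2 (h.1.isCartesianProduct_iff.2 ⟨s, h1, h2, h4, h3⟩)
    obtain ⟨S', T', h', ⟨t, ht, ht0⟩, hS, hT⟩ :=
      (hsymm h).extendVec_of_corner_subset hnt.nonempty hr.symm hN ha ha0 hL haT
    refine ⟨B, C, D, a, N, 0, T', S', hnt, ha, hr.interval, hsymm h', fun hc => ?_, fun _ => rfl,
      hT, hS⟩
    rw [hc] at ht
    exact absurd ht ht0

end Contract

/-! ### Trees from parent maps -/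

/-- A rooted tree given by the parents and the depths of its nodes. -/
structure ParentTree (V : Type*) where
  root : V
  parent : V → V
  depth : V → ℕ
  depth_root : depth root = 0
  depth_parent : ∀ v, v ≠ root → depth v = depth (parent v) + 1

namespace ParentTree

variable {V : Type*} (P : ParentTree V)

/-- Every node other than the root is joined to its parent. -/
def graph : SimpleGraph V where
  Adj u v := (v ≠ P.root ∧ P.parent v = u) ∨ (u ≠ P.root ∧ P.parent u = v)
  symm := ⟨fun _ _ h => h.symm⟩
  loopless := ⟨by
    rintro v (⟨h, e⟩ | ⟨h, e⟩) <;>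
    · have := P.depth_parent v h
      rw [e] at this
      omega⟩

theorem adj_parent {v : V} (h : v ≠ P.root) : P.graph.Adj (P.parent v) v := Or.inl ⟨h, rfl⟩

theorem exists_walk (v : V) : ∃ p : P.graph.Walk P.root v, p.length = P.depth v := by
  induction hd : P.depth v generalizing v with
  | zero =>
    by_cases hv : v = P.root
    · subst hv
      exact ⟨.nil, rfl⟩
    · have := P.depth_parent v hv
      omega
  | succ d ih =>
    have hv : v ≠ P.root := by
      rintro rfl
      have := P.depth_root
      omega
    obtain ⟨p, hp⟩ := ih (P.parent v) (by have := P.depth_parent v hv; omega)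
    exact ⟨p.concat (P.adj_parent hv), by rw [SimpleGraph.Walk.length_concat, hp]⟩

theorem depth_le_of_walk {u v : V} (p : P.graph.Walk u v) : P.depth v ≤ P.depth u + p.length := by
  induction p with
  | nil => simp
  | cons h p ih =>
    rw [SimpleGraph.Walk.length_cons]
    rcases h with ⟨h, rfl⟩ | ⟨h, rfl⟩ <;>
    · have := P.depth_parent _ h
      omega

theorem connected : P.graph.Connected := by
  have hr : ∀ v, P.graph.Reachable P.root v := fun v => ⟨(P.exists_walk v).choose⟩
  have : Nonempty V := ⟨P.root⟩
  exact ⟨fun u v => (hr u).symm.trans (hr v)⟩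

theorem dist_root (v : V) : P.graph.dist P.root v = P.depth v := by
  apply le_antisymm
  · obtain ⟨p, hp⟩ := P.exists_walk v
    rw [← hp]
    exact SimpleGraph.dist_le p
  · obtain ⟨p, hp⟩ := P.connected.exists_walk_length_eq_dist P.root v
    have := P.depth_le_of_walk p
    rw [P.depth_root] at this
    omega

/-- A connected graph with one edge fewer than nodes is a tree; here each node other than the root
accounts for exactly the edge to its parent. -/
theorem isTree [Finite V] : P.graph.IsTree := by
  classical
  rw [SimpleGraph.isTree_iff_connected_and_card]
  refine ⟨P.connected, ?_⟩
  let f : {v // v ≠ P.root} → P.graph.edgeSet := fun v => ⟨s(P.parent v, v), P.adj_parent v.2⟩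
  have hf : Function.Bijective f := by
    constructor
    · rintro ⟨v, hv⟩ ⟨w, hw⟩ e
      have e' : s(P.parent v, v) = s(P.parent w, w) := congrArg Subtype.val e
      rw [Sym2.eq_iff] at e'
      rcases e' with ⟨-, e'⟩ | ⟨e1, e2⟩
      · exact Subtype.ext e'
      · have h1 := P.depth_parent v hv
        have h2 := P.depth_parent w hw
        rw [e1] at h1
        rw [← e2] at h2
        omega
    · rintro ⟨e, he⟩
      induction e with
      | h u v =>
      rcases he with ⟨h, e⟩ | ⟨h, e⟩
      · exact ⟨⟨v, h⟩, Subtype.ext (by simp [f, e])⟩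
      · exact ⟨⟨u, h⟩, Subtype.ext (by simp [f, e, Sym2.eq_swap])⟩
  rw [← Nat.card_congr (Equiv.ofBijective f hf)]
  have := Fintype.ofFinite V
  rw [Nat.card_eq_fintype_card, Nat.card_eq_fintype_card, Fintype.card_subtype_compl,
    Fintype.card_subtype_eq]
  have : 0 < Fintype.card V := Fintype.card_pos_iff.2 ⟨P.root⟩
  omega

/-- The rooted tree with the given parents. -/
def toRootedTree [Finite V] : RootedTree V := ⟨P.graph, P.isTree, P.root⟩

theorem mem_offspring [Finite V] {u v : V} :
    v ∈ P.toRootedTree.offspring u ↔ v ≠ P.root ∧ P.parent v = u := by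
  change P.graph.Adj u v ∧ P.graph.dist P.root v = P.graph.dist P.root u + 1 ↔ _
  rw [dist_root, dist_root]
  constructor
  · rintro ⟨h | ⟨h, e⟩, hd⟩
    · exact h
    · have := P.depth_parent u h
      rw [e] at this
      omega
  · rintro ⟨h, rfl⟩
    exact ⟨P.adj_parent h, P.depth_parent v h⟩

end ParentTree

/-! ### Transporting a generation along an embedding of trees -/

section Transfer

variable {V V' : Type*} {f : V' → V}

/-- Extension by zero of exponent vectors along a map of the sets of variables. -/
noncomputable abbrev pushVec (f : V' → V) : (V' → ℕ) →+ (V → ℕ) := Function.ExtendByZero.hom ℕ f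

theorem pushVec_apply (hf : Function.Injective f) (y : V' → ℕ) (v : V') :
    pushVec f y (f v) = y v := hf.extend_apply y 0 v

theorem pushVec_notMem (y : V' → ℕ) {v : V} (hv : v ∉ Set.range f) : pushVec f y v = 0 :=
  Function.extend_apply' y (0 : V → ℕ) v hv

theorem eq_pushVec (hf : Function.Injective f) {y : V → ℕ} {y' : V' → ℕ}
    (h : ∀ v, y (f v) = y' v) (h0 : ∀ v ∉ Set.range f, y v = 0) : y = pushVec f y' := by
  ext v
  by_cases hv : v ∈ Set.range f
  · obtain ⟨v, rfl⟩ := hv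
    rw [pushVec_apply hf, h]
  · rw [pushVec_notMem _ hv, h0 v hv]

theorem notMem_image_of_notMem_range {B : Set V'} {v : V} (h : v ∉ Set.range f) : v ∉ f '' B :=
  fun hc => h (Set.image_subset_range f B hc)

theorem pushVec_image_box (hf : Function.Injective f) (B : Set V') (C : V → Set ℕ) :
    pushVec f '' box B (C ∘ f) = box (f '' B) C := by
  ext y
  constructor
  · rintro ⟨y, ⟨h1, h2⟩, rfl⟩
    refine ⟨?_, fun v hv => ?_⟩
    · rintro _ ⟨v, hv, rfl⟩
      rw [pushVec_apply hf]
      exact h1 v hv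
    · by_cases hr : v ∈ Set.range f
      · obtain ⟨v, rfl⟩ := hr
        rw [pushVec_apply hf]
        exact h2 v fun hc => hv ⟨v, hc, rfl⟩
      · exact pushVec_notMem _ hr
  · rintro ⟨h1, h2⟩
    refine ⟨y ∘ f, ⟨fun v hv => h1 _ ⟨v, hv, rfl⟩, fun v hv => h2 _ ?_⟩,
      (eq_pushVec hf (fun _ => rfl) fun v hv => h2 v (notMem_image_of_notMem_range hv)).symm⟩
    rwa [hf.mem_set_image]

theorem pushVec_image_corner (hf : Function.Injective f) (B : Set V') (a : V → ℕ) :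
    pushVec f '' corner B (a ∘ f) = corner (f '' B) a := by
  ext y
  constructor
  · rintro ⟨y, ⟨h1, h2⟩, rfl⟩
    refine ⟨fun v hv => ?_, fun hc => h2 fun v hv => ?_⟩
    · by_cases hr : v ∈ Set.range f
      · obtain ⟨v, rfl⟩ := hr
        rw [pushVec_apply hf]
        exact h1 v fun hc => hv ⟨v, hc, rfl⟩
      · exact pushVec_notMem _ hr
    · have := hc _ ⟨v, hv, rfl⟩
      rwa [pushVec_apply hf] at this
  · rintro ⟨h1, h2⟩
    refine ⟨y ∘ f, ⟨fun v hv => h1 _ ?_, fun hc => h2 ?_⟩,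
      (eq_pushVec hf (fun _ => rfl) fun v hv => h1 v (notMem_image_of_notMem_range hv)).symm⟩
    · rwa [hf.mem_set_image]
    · rintro _ ⟨v, hv, rfl⟩
      exact hc v hv

theorem pushVec_image_cornerPow (hf : Function.Injective f) (B : Set V') (a N : V → ℕ)
    (ε : Fin 2) : pushVec f '' cornerPow B (a ∘ f) (N ∘ f) ε = cornerPow (f '' B) a N ε := by
  unfold cornerPow
  split_ifs with h
  · rw [← pushVec_image_corner hf, Set.image_image, Set.image_image]
    refine Set.image_congr fun y _ => (eq_pushVec hf (fun v => ?_) fun v hv => ?_).symm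
    · rw [pushVec_apply hf]
      rfl
    · rw [pushVec_notMem _ hv, mul_zero]
  · rw [Set.image_singleton, map_zero]

theorem pushVec_substitute (hf : Function.Injective f) (z : V') (B : Set V') (b : V → ℕ)
    (t : V' → ℕ) :
    pushVec f (substitute z B (b ∘ f) t) = substitute (f z) (f '' B) b (pushVec f t) := by
  refine (eq_pushVec hf (fun v => ?_) fun v hv => ?_).symm
  · have h1 : f v ∈ f '' B ↔ v ∈ B := hf.mem_set_image
    by_cases hB : v ∈ B
    · simp only [substitute, h1.2 hB, hB, if_true, pushVec_apply hf, Function.comp_apply]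
    · have hB' : f v ∉ f '' B := fun hc => hB (h1.1 hc)
      by_cases hz : v = z
      · subst hz
        simp only [substitute, hB', hB, if_false, if_true]
      · have hz' : f v ≠ f z := hf.ne hz
        simp only [substitute, hB', hB, hz, hz', if_false, pushVec_apply hf]
  · have h1 : v ∉ f '' B := notMem_image_of_notMem_range hv
    have h2 : v ≠ f z := fun e => hv ⟨z, e.symm⟩
    simp only [substitute, h1, h2, if_false, pushVec_notMem _ hv]

theorem pushVec_image_extend (hf : Function.Injective f) (z : V') (B : Set V') (C : V → Set ℕ)
    (a N : V → ℕ) (ε : Fin 2) (T : Set (V' → ℕ)) :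
    pushVec f '' extend z B (C ∘ f) (a ∘ f) (N ∘ f) ε T =
      extend (f z) (f '' B) C a N ε (pushVec f '' T) := by
  unfold extend
  rw [Set.image_add, Set.image_add, pushVec_image_box hf, pushVec_image_cornerPow hf,
    Set.image_image, Set.image_image]
  congr 1
  exact Set.image_congr fun t _ => pushVec_substitute hf z B (fun v => a v * N v) t

/-- A run of removals in the small tree is also a run inside the large one. A former top may have
acquired offsprings, but only outside the image, where the subtree does not see them. -/
theorem Generates.map {Γ' : RootedTree V'} {Γ : RootedTree V} {W' : Weight Γ'} {W : Weight Γ}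
    (hf : Function.Injective f) (hroot : f Γ'.root = Γ.root)
    (hoff : ∀ v, ¬ Γ'.IsTop v → Γ.offspring (f v) = f '' Γ'.offspring v)
    (htop : ∀ v, Γ'.IsTop v → Disjoint (Γ.offspring (f v)) (Set.range f))
    (hT : W.T₀ = W'.T₀) (hS : W.S₀ = W'.S₀) (hδ : ∀ v, ¬ Γ'.IsTop v → W.δ (f v) = W'.δ v)
    (hα : W.α ∘ f = W'.α) (hC : W.C ∘ f = W'.C) (hD : W.D ∘ f = W'.D)
    (hsize : W.size ∘ f = W'.size) {U : Set V'} {T S : Set (V' → ℕ)} (h : Generates W' U T S) :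
    Generates W (f '' U) (pushVec f '' T) (pushVec f '' S) := by
  induction h with
  | root =>
    have := Generates.root (W := W)
    rw [← hroot, ← Set.image_singleton, hT, hS] at this
    rw [← pushVec_image_box hf, ← pushVec_image_box hf] at this
    exact this
  | branch U z T S mem nonempty subset tops _ ih =>
    have hz : ¬ Γ'.IsTop z := nonempty.ne_empty
    rw [← hα, ← hC, ← hD, ← hsize, pushVec_image_extend hf, pushVec_image_extend hf, ← hδ z hz,
      ← hoff z hz]
    refine Generates.branch (f '' U) (f z) _ _ (Set.mem_image_of_mem f mem) ?_ ?_ ?_ ?_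
    · rw [hoff z hz]
      exact nonempty.image f
    · rw [hoff z hz]
      exact Set.image_mono subset
    · rw [hoff z hz]
      rintro _ ⟨x, hx, rfl⟩
      by_cases hxt : Γ'.IsTop x
      · exact (htop x hxt).mono_right (Set.image_subset_range f U)
      · rw [hoff x hxt, Set.disjoint_image_iff hf]
        exact tops x hx
    · rw [hoff z hz, ← Set.image_sdiff hf]
      exact ih

end Transfer

/-! ### Grafting offsprings onto a node -/

section Graft

variable {V : Type*} {β : Type*}

/-- The tree obtained by adding the nodes of `β` as offsprings of the node `z`. -/
def ParentTree.graft (P : ParentTree V) (z : V) (β : Type*) : ParentTree (V ⊕ β) where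
  root := .inl P.root
  parent := Sum.elim (fun v => .inl (P.parent v)) (fun _ => .inl z)
  depth := Sum.elim P.depth (fun _ => P.depth z + 1)
  depth_root := P.depth_root
  depth_parent := by
    rintro (v | b) h
    · exact P.depth_parent v fun e => h (by rw [e])
    · rfl

variable [Finite V] [Finite β] (P : ParentTree V) (z : V)

theorem ParentTree.inl_mem_offspring_graft {u v : V} :
    Sum.inl v ∈ (P.graft z β).toRootedTree.offspring (.inl u) ↔
      v ∈ P.toRootedTree.offspring u := by
  simp [mem_offspring, graft]

theorem ParentTree.inr_mem_offspring_graft {u : V} {b : β} :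
    Sum.inr b ∈ (P.graft z β).toRootedTree.offspring (.inl u) ↔ z = u := by
  simp [mem_offspring, graft]

theorem ParentTree.isTop_graft_inr (b : β) : (P.graft z β).toRootedTree.IsTop (.inr b) := by
  rw [RootedTree.IsTop, Set.eq_empty_iff_forall_notMem]
  rintro (v | b') <;> simp [mem_offspring, graft]

theorem ParentTree.offspring_graft_of_ne {u : V} (hu : u ≠ z) :
    (P.graft z β).toRootedTree.offspring (.inl u) = Sum.inl '' P.toRootedTree.offspring u := by
  ext (v | b)
  · rw [inl_mem_offspring_graft]
    simp
  · rw [inr_mem_offspring_graft]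
    simp [hu.symm]

theorem ParentTree.offspring_graft_self (hz : P.toRootedTree.IsTop z) :
    (P.graft z β).toRootedTree.offspring (.inl z) = Set.range Sum.inr := by
  ext (v | b)
  · rw [inl_mem_offspring_graft, show P.toRootedTree.offspring z = ∅ from hz]
    simp
  · rw [inr_mem_offspring_graft]
    simp

theorem ParentTree.isTop_graft_inl [Nonempty β] {v : V} :
    (P.graft z β).toRootedTree.IsTop (.inl v) ↔ P.toRootedTree.IsTop v ∧ v ≠ z := by
  constructor
  · intro h
    rw [RootedTree.IsTop, Set.eq_empty_iff_forall_notMem] at h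
    refine ⟨Set.eq_empty_iff_forall_notMem.2 fun u hu =>
      h (.inl u) ((P.inl_mem_offspring_graft z).2 hu), ?_⟩
    rintro rfl
    obtain ⟨b⟩ := ‹Nonempty β›
    exact h (.inr b) ((P.inr_mem_offspring_graft _).2 rfl)
  · rintro ⟨h, hne⟩
    rw [RootedTree.IsTop, P.offspring_graft_of_ne z hne, show P.toRootedTree.offspring v = ∅ from h,
      Set.image_empty]

open Classical in
/-- The weight of the grafted tree that extends `W`. -/
noncomputable def Weight.graft {P : ParentTree V} (W : Weight P.toRootedTree) (z : V)
    (C D : β → Set ℕ) (a N : β → ℕ) (ε : Fin 2) (ha : ∀ b, 0 < a b)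
    (hC : ∀ b, IsIntervalPair (N b) (C b) (D b))
    (hroot : P.root ≠ z → ¬ P.toRootedTree.IsTop P.root)
    (hT : P.root = z → W.T₀ = {0} → ε = 1) (hS : P.root = z → W.S₀ = {0} → ε = 0) :
    Weight (P.graft z β).toRootedTree where
  T₀ := W.T₀
  S₀ := W.S₀
  initial := W.initial
  δ := Sum.elim (fun v => if v = z then ε else W.δ v) fun _ => 0
  α := Sum.elim W.α a
  C := Sum.elim W.C C
  D := Sum.elim W.D D
  size := Sum.elim W.size N
  α_pos := by
    rintro (v | b) h
    · exact W.α_pos v fun e => h (by rw [e]; rfl)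
    · exact ha b
  interval := by
    rintro (v | b) h
    · exact W.interval v fun e => h (by rw [e]; rfl)
    · exact hC b
  δ_root_of_left := by
    intro _ h
    change (if P.root = z then ε else W.δ P.root) = 1
    split_ifs with hz
    · exact hT hz h
    · exact W.δ_root_of_left (hroot hz) h
  δ_root_of_right := by
    intro _ h
    change (if P.root = z then ε else W.δ P.root) = 0
    split_ifs with hz
    · exact hS hz h
    · exact W.δ_root_of_right (hroot hz) h

end Graft

/-! ### Every primitive pair comes from a tree -/

section Realize

/-- The pair `(T, S)` is generated by a weighted tree whose tops are indexed by `ι`. -/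
def IsRealizable {ι : Type} (T S : Set (ι → ℕ)) : Prop :=
  ∃ (V : Type) (_ : Finite V) (P : ParentTree V) (W : Weight P.toRootedTree)
    (e : ι ≃ {v // P.toRootedTree.IsTop v}),
    P.toRootedTree.IsBranching ∧
    (∃ T' S', Generates W Set.univ T' S' ∧ T = (fun y i => y (e i)) '' T' ∧
      S = (fun y i => y (e i)) '' S') ∧
    -- When the root is about to receive its first offsprings, this clause turns conditions on the
    -- initial pair into conditions on `(T, S)`, which control `δ` at the root.
    (P.toRootedTree.IsTop P.root → Subsingleton V ∧ (W.T₀ = {0} → T = {0}) ∧ (W.S₀ = {0} → S = {0}))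

theorem isRealizable_of_unique {ι : Type} [Unique ι] {T S : Set (ι → ℕ)} (h : IsNPair T S) :
    IsRealizable T S := by
  let P : ParentTree Unit := ⟨(), id, fun _ => 0, rfl, fun v hv => absurd rfl hv⟩
  have htop : ∀ v, P.toRootedTree.IsTop v := by
    intro v
    rw [RootedTree.IsTop, Set.eq_empty_iff_forall_notMem]
    intro u hu
    exact (P.mem_offspring.1 hu).1 rfl
  let c : ℕ → ι → ℕ := fun k _ => k
  have hcT : ∀ x : ι → ℕ, c (x default) = x := fun x => by
    ext i
    rw [Unique.eq_default i]
  have hpair : IsPairOf Set.univ (c ⁻¹' T) (c ⁻¹' S) := by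
    refine .of_exists_unique (Set.subset_univ _) (Set.subset_univ _)
      (fun _ _ _ _ => Set.mem_univ _) ?_ ?_
    · intro k _
      obtain ⟨t, ht, s, hs, e⟩ := h.exists_add (c k)
      refine ⟨t default, ?_, s default, ?_, congrFun e default⟩
      · rwa [Set.mem_preimage, hcT]
      · rwa [Set.mem_preimage, hcT]
    · intro t ht t' ht' s hs s' hs' e
      have := h.eq_and_eq ht ht' hs hs' (by ext i; exact e)
      exact ⟨congrFun this.1 default, congrFun this.2 default⟩
  let W : Weight P.toRootedTree :=
    { T₀ := c ⁻¹' T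
      S₀ := c ⁻¹' S
      initial := hpair
      -- The only node is both root and top, so this value and those of `α`, `C`, `D`, `size` are
      -- placeholders.
      δ := fun _ => 0
      α := fun _ => 1
      C := fun _ => {0}
      D := fun _ => {0}
      size := fun _ => 1
      α_pos := fun v hv => absurd rfl hv
      interval := fun v hv => absurd rfl hv
      δ_root_of_left := fun hn => absurd (htop _) hn
      δ_root_of_right := fun hn => absurd (htop _) hn }
  have : Unique {v // P.toRootedTree.IsTop v} := ⟨⟨⟨(), htop _⟩⟩, fun _ => rfl⟩
  have hroot : ∀ v : Unit, v = P.toRootedTree.root := fun _ => rfl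
  have himg : ∀ R : Set (ι → ℕ), R = (fun (y : Unit → ℕ) (i : ι) =>
      y ((Equiv.ofUnique ι {v // P.toRootedTree.IsTop v}) i).1) ''
        box {P.toRootedTree.root} fun _ => c ⁻¹' R := by
    intro R
    ext x
    constructor
    · intro hx
      refine ⟨fun _ => x default, ⟨fun v _ => ?_, fun v hv => absurd (hroot v) hv⟩, hcT x⟩
      rwa [Set.mem_preimage, hcT]
    · rintro ⟨y, ⟨h1, -⟩, rfl⟩
      exact h1 () rfl
  refine ⟨Unit, inferInstance, P, W, Equiv.ofUnique _ _, fun v hv => absurd (htop v) hv,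
    ⟨_, _, ?_, himg T, himg S⟩, fun _ => ⟨inferInstance, ?_, ?_⟩⟩
  · have h1 : (Set.univ : Set Unit) = {P.toRootedTree.root} := by
      ext v
      simp [hroot v]
    rw [h1]
    exact Generates.root (W := W)
  · intro h0
    change c ⁻¹' T = {0} at h0
    ext x
    rw [← hcT x, ← Set.mem_preimage, h0]
    exact ⟨fun h => by rw [h]; rfl, fun h => congrFun h default⟩
  · intro h0
    change c ⁻¹' S = {0} at h0
    ext x
    rw [← hcT x, ← Set.mem_preimage, h0]
    exact ⟨fun h => by rw [h]; rfl, fun h => congrFun h default⟩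

/-- Reading the exponents of the tops of a grafted tree turns the extension along the new nodes
into `extendVec`. -/
theorem image_extend_inl {ι V : Type} {B : Set ι} {z : V} {g : ι → V ⊕ B}
    {k : Option {i // i ∉ B} → V} (hgB : ∀ i (h : i ∈ B), g i = .inr ⟨i, h⟩)
    (hg : ∀ i (h : i ∉ B), g i = .inl (k (some ⟨i, h⟩))) (hk : Function.Injective k)
    (hz : k none = z) (C : ι → Set ℕ) (a N : ι → ℕ) (C' : V ⊕ B → Set ℕ) (a' N' : V ⊕ B → ℕ)
    (hC : ∀ b : B, C' (.inr b) = C b) (ha : ∀ b : B, a' (.inr b) = a b)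
    (hN : ∀ b : B, N' (.inr b) = N b) (ε : Fin 2) (R : Set (V → ℕ)) :
    extendVec B C a N ε ((fun y o => y (k o)) '' R) =
      (fun y i => y (g i)) ''
        extend (.inl z) (Set.range .inr) C' a' N' ε (pushVec Sum.inl '' R) := by
  have hinl : Function.Injective (Sum.inl : V → V ⊕ B) := Sum.inl_injective
  have hsub : ∀ (t : V → ℕ) (b : B), substitute (.inl z) (Set.range .inr)
      (fun v => a' v * N' v) (pushVec Sum.inl t) (.inr b) = t z * (a b * N b) := by
    intro t b
    simp only [substitute, Set.mem_range_self, if_true, pushVec_apply hinl, ha, hN]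
  have hsub' : ∀ (t : V → ℕ) (v : V), v ≠ z → substitute (.inl z) (Set.range .inr)
      (fun v => a' v * N' v) (pushVec Sum.inl t) (.inl v) = t v := by
    intro t v hv
    have h1 : (Sum.inl v : V ⊕ B) ∉ Set.range Sum.inr := by simp
    have h2 : (Sum.inl v : V ⊕ B) ≠ Sum.inl z := hinl.ne hv
    simp only [substitute, h1, h2, if_false, pushVec_apply hinl]
  have hkz : ∀ i, k (some i) ≠ z := by
    rintro i e
    have := hk (e.trans hz.symm)
    simp at this
  ext x
  constructor
  · rintro ⟨c, hc, l, hl, _, ⟨t, ht, rfl⟩, h1, h2⟩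
    refine ⟨_, Set.add_mem_add (Set.add_mem_add (a := Sum.elim (fun _ => 0) fun b : B => c b)
      (b := fun v => N' v * Sum.elim (fun _ => 0) (fun b : B => l b) v) ?_ ?_)
      (Set.mem_image_of_mem _ (Set.mem_image_of_mem _ ht)), ?_⟩
    · refine ⟨?_, ?_⟩
      · rintro _ ⟨b, rfl⟩
        rw [hC]
        exact hc b b.2
      · rintro (v | b) hv
        · rfl
        · exact absurd (Set.mem_range_self b) hv
    · unfold cornerPow
      rw [cornerOrZero] at hl
      split_ifs at hl ⊢ with hε
      · refine ⟨_, ⟨?_, fun hc => hl.2 fun i hi => ?_⟩, rfl⟩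
        · rintro (v | b) hv
          · rfl
          · exact absurd (Set.mem_range_self b) hv
        · have := hc (.inr ⟨i, hi⟩) (Set.mem_range_self _)
          rwa [ha] at this
      · rw [Set.mem_singleton_iff.1 hl]
        ext (v | b) <;> simp
    · ext i
      by_cases hi : i ∈ B
      · simp only [hgB i hi, Pi.add_apply, hsub, Sum.elim_inr, hN, h1 i hi, hz]
      · simp only [hg i hi, Pi.add_apply, hsub' _ _ (hkz _), Sum.elim_inl, h2 i hi, mul_zero,
          zero_add]
  · rintro ⟨_, ⟨_, ⟨c, hc, l, hl, rfl⟩, _, ⟨_, ⟨t, ht, rfl⟩, rfl⟩, rfl⟩, rfl⟩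
    obtain ⟨l', hl', hll⟩ : ∃ l' ∈ cornerOrZero B a ε, (∀ b : B, l (.inr b) = N b * l' b) ∧
        ∀ v, l (.inl v) = 0 := by
      unfold cornerPow at hl
      unfold cornerOrZero
      split_ifs at hl ⊢ with hε
      · obtain ⟨l, hl, rfl⟩ := hl
        classical
        refine ⟨fun i => if h : i ∈ B then l (.inr ⟨i, h⟩) else 0,
          ⟨fun i hi => dif_neg hi, fun hc => hl.2 ?_⟩, fun b => ?_, fun v => ?_⟩
        · rintro _ ⟨b, rfl⟩
          have := hc b b.2
          beta_reduce at this
          rw [dif_pos b.2] at this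
          rwa [ha]
        · simp only [hN, Subtype.coe_prop, dite_true, Subtype.coe_eta]
        · simp only [hl.1 (.inl v) (by simp), mul_zero]
      · rw [Set.mem_singleton_iff.1 hl]
        exact ⟨0, rfl, fun b => by simp, fun v => rfl⟩
    classical
    refine ⟨fun i => if h : i ∈ B then c (.inr ⟨i, h⟩) else 0, fun i hi => ?_, l', hl', _,
      ⟨t, ht, rfl⟩, fun i hi => ?_, fun i hi => ?_⟩
    · beta_reduce
      rw [dif_pos hi]
      have := hc.1 (.inr ⟨i, hi⟩) (Set.mem_range_self _)
      rwa [hC] at this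
    · simp only [hgB i hi, Pi.add_apply, hsub, dif_pos hi, hll.1, hz]
    · simp only [hg i hi, Pi.add_apply, hsub' _ _ (hkz _), hll.2, hc.2 (.inl _) (by simp),
        zero_add]

/-- The variables of `B` are grafted onto the top `z` that stands for `none`. Removing them again is
the last recursion step at `z`, and what remains is a copy of the old tree. -/
theorem IsRealizable.extendVec {ι : Type} [Finite ι] {B : Set ι} (hB : B.Nontrivial)
    {C D : ι → Set ℕ} {a N : ι → ℕ} {ε : Fin 2} {T S : Set (Option {i // i ∉ B} → ℕ)}
    (ha : ∀ i ∈ B, 0 < a i) (hC : ∀ i, IsIntervalPair (N i) (C i) (D i)) (hT : T = {0} → ε = 1)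
    (hS : S = {0} → ε = 0) (h : IsRealizable T S) :
    IsRealizable (extendVec B C a N ε T) (extendVec B D a N (1 - ε) S) := by
  classical
  obtain ⟨V, _, P, W, e, hbr, ⟨T', S', hgen, hT', hS'⟩, htop⟩ := h
  obtain ⟨z, hzdef⟩ : ∃ z : V, z = e none := ⟨_, rfl⟩
  have hz : P.toRootedTree.IsTop z := hzdef ▸ (e none).2
  have hroot : P.root ≠ z → ¬ P.toRootedTree.IsTop P.root := fun hne ht =>
    hne ((htop ht).1.elim _ _)
  have hnB : Nonempty B := hB.nonempty.to_subtype
  let W' : Weight (P.graft z B).toRootedTree :=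
    W.graft z (fun b => C b) (fun b => D b) (fun b => a b) (fun b => N b) ε (fun b => ha b b.2)
      (fun b => hC b) hroot (fun hr h0 => hT ((htop (hr ▸ hz)).2.1 h0))
      (fun hr h0 => hS ((htop (hr ▸ hz)).2.2 h0))
  let k : Option {i // i ∉ B} → V := fun o => e o
  have hk : Function.Injective k := Subtype.val_injective.comp e.injective
  have hkz : ∀ i, k (some i) ≠ z := by
    intro i hi
    have := hk (hi.trans hzdef)
    simp at this
  -- Variables in `B` label the new nodes; the others keep their old tops, none of which is `z`.
  let g : ι → {v // (P.graft z B).toRootedTree.IsTop v} := fun i =>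
    if h : i ∈ B then ⟨.inr ⟨i, h⟩, P.isTop_graft_inr z _⟩
    else ⟨.inl (k (some ⟨i, h⟩)), (P.isTop_graft_inl z).2 ⟨(e _).2, hkz _⟩⟩
  have hgB : ∀ i (h : i ∈ B), (g i).1 = .inr ⟨i, h⟩ := fun i h => by simp [g, h]
  have hg : ∀ i (h : i ∉ B), (g i).1 = .inl (k (some ⟨i, h⟩)) := fun i h => by simp [g, h]
  have hbij : Function.Bijective g := by
    constructor
    · intro i j hij
      have hij' := congrArg Subtype.val hij
      by_cases hi : i ∈ B <;> by_cases hj : j ∈ B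
      · rw [hgB i hi, hgB j hj] at hij'
        simpa using hij'
      · rw [hgB i hi, hg j hj] at hij'
        simp at hij'
      · rw [hg i hi, hgB j hj] at hij'
        simp at hij'
      · rw [hg i hi, hg j hj, Sum.inl_injective.eq_iff, hk.eq_iff] at hij'
        simpa using hij'
    · rintro ⟨v | b, hv⟩
      · obtain ⟨h1, h2⟩ := (P.isTop_graft_inl z).1 hv
        obtain ⟨o, ho⟩ := e.surjective ⟨v, h1⟩
        rcases o with _ | ⟨i, hi⟩
        · rw [ho] at hzdef
          exact absurd hzdef.symm h2
        · refine ⟨i, Subtype.ext ?_⟩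
          rw [hg i hi]
          simp [k, ho]
      · exact ⟨b, Subtype.ext (hgB b b.2)⟩
  refine ⟨V ⊕ B, inferInstance, P.graft z B, W', Equiv.ofBijective g hbij, ?_,
    ⟨_, _, Generates.branch Set.univ (.inl z) (pushVec Sum.inl '' T') (pushVec Sum.inl '' S')
      (Set.mem_univ _) ?_ (Set.subset_univ _) ?_ ?_, ?_, ?_⟩, ?_⟩
  · rintro (v | b) hv
    · by_cases hvz : v = z
      · rw [hvz, P.offspring_graft_self z hz]
        obtain ⟨x, hx, y, hy, hxy⟩ := hB
        exact ⟨.inr ⟨x, hx⟩, Set.mem_range_self _, .inr ⟨y, hy⟩, Set.mem_range_self _,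
          by simpa using hxy⟩
      · have hv' : ¬ P.toRootedTree.IsTop v := fun hc => hv ((P.isTop_graft_inl z).2 ⟨hc, hvz⟩)
        rw [P.offspring_graft_of_ne z hvz]
        exact (hbr v hv').image Sum.inl_injective
    · exact absurd (P.isTop_graft_inr z b) hv
  · rw [P.offspring_graft_self z hz]
    exact Set.range_nonempty _
  · rw [P.offspring_graft_self z hz]
    rintro _ ⟨b, rfl⟩
    rw [show (P.graft z B).toRootedTree.offspring (.inr b) = ∅ from P.isTop_graft_inr z b]
    exact Set.empty_disjoint _
  · have hU : Set.univ \ (P.graft z B).toRootedTree.offspring (.inl z) =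
        Sum.inl '' (Set.univ : Set V) := by
      rw [P.offspring_graft_self z hz]
      ext (v | b) <;> simp
    rw [hU]
    refine hgen.map Sum.inl_injective rfl (fun v hv => ?_) (fun v hv => ?_) rfl rfl (fun v hv => ?_)
      rfl rfl rfl rfl
    · exact P.offspring_graft_of_ne z fun hc => hv (hc ▸ hz)
    · rw [Set.disjoint_left]
      rintro _ h1 ⟨u, rfl⟩
      rw [P.inl_mem_offspring_graft z, show P.toRootedTree.offspring v = ∅ from hv] at h1
      exact h1
    · exact if_neg fun hc : v = z => hv (hc ▸ hz)
  · rw [P.offspring_graft_self z hz, hT', show W'.δ (.inl z) = ε from if_pos rfl]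
    exact image_extend_inl hgB hg hk hzdef.symm C a N W'.C W'.α W'.size (fun _ => rfl)
      (fun _ => rfl) (fun _ => rfl) ε T'
  · rw [P.offspring_graft_self z hz, hS', show W'.δ (.inl z) = ε from if_pos rfl]
    exact image_extend_inl hgB hg hk hzdef.symm D a N W'.D W'.α W'.size (fun _ => rfl)
      (fun _ => rfl) (fun _ => rfl) (1 - ε) S'
  · intro ht
    obtain ⟨h1, h2⟩ := (P.isTop_graft_inl z).1 ht
    exact absurd h1 (hroot h2)

theorem IsPrimitiveNPair.isRealizable {ι : Type} [Finite ι] [Nonempty ι] {T S : Set (ι → ℕ)}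
    (h : IsPrimitiveNPair T S) : IsRealizable T S := by
  induction hn : Nat.card ι using Nat.strong_induction_on generalizing ι with
  | _ n ih =>
  rcases subsingleton_or_nontrivial ι with hs | hnt
  · have : Unique ι := uniqueOfSubsingleton (Classical.arbitrary ι)
    exact isRealizable_of_unique h.1
  · obtain ⟨B, C, D, a, N, ε, T', S', hB, ha, hC, h', hT', hS', rfl, rfl⟩ := h.exists_extendVec
    -- Since `B` has at least two elements, replacing it by one variable lowers the number of
    -- variables.
    refine IsRealizable.extendVec hB ha hC hT' hS' (ih _ ?_ h' rfl)
    rw [← hn, Finite.card_option]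
    have h1 : Nat.card {i // i ∉ B} + B.ncard = Nat.card ι := by
      rw [add_comm]
      exact Set.ncard_add_ncard_compl B
    have h2 : 1 < B.ncard := (Set.one_lt_ncard_iff_nontrivial).2 hB
    omega

end Realize

/-! ### Primitive pairs on a set of variables -/

section Face

variable {V : Type*} {X X' : Set V} {T S : Set (V → ℕ)}

/-- The exponent vectors of the monomials in the variables of `X`. -/
def faceSet (X : Set V) : Set (V → ℕ) := {y | ∀ v ∉ X, y v = 0}

/-- `(T, S)` is a primitive pair in the variables of `X`. -/
structure IsPrimitiveOn (X : Set V) (T S : Set (V → ℕ)) : Prop where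
  pair : IsPairOf (faceSet X) T S
  not_splits : ∀ s : Set V, (s ∩ X).Nonempty → (X \ s).Nonempty →
    ¬ (SplitsAt s T ∧ SplitsAt s S)

theorem IsPrimitiveOn.symm (h : IsPrimitiveOn X T S) : IsPrimitiveOn X S T :=
  ⟨h.pair.symm, fun s h1 h2 h3 => h.not_splits s h1 h2 h3.symm⟩

theorem add_mem_faceSet {x y : V → ℕ} (hx : x ∈ faceSet X) (hy : y ∈ faceSet X) :
    x + y ∈ faceSet X := fun v hv => by rw [Pi.add_apply, hx v hv, hy v hv]

theorem mem_faceSet_of_le {x y : V → ℕ} (hx : x ∈ faceSet X) (h : y ≤ x) : y ∈ faceSet X :=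
  fun v hv => Nat.le_zero.1 ((h v).trans (hx v hv).le)

theorem IsPairOf.zero_mem_of_faceSet (h : IsPairOf (faceSet X) T S) : 0 ∈ T := by
  refine h.zero_mem (fun _ _ => rfl) fun a b e => ?_
  ext i
  have := congrFun e i
  simp only [Pi.add_apply, Pi.zero_apply] at this ⊢
  omega

theorem splitsAt_of_forall_mem_faceSet {s : Set V} (hT : T ⊆ faceSet X)
    (h : ∀ x ∈ faceSet X, x ∈ T ↔ s.indicator x ∈ T ∧ sᶜ.indicator x ∈ T) : SplitsAt s T := by
  intro x
  by_cases hx : x ∈ faceSet X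
  · exact h x hx
  · refine iff_of_false (fun hc => hx (hT hc)) fun ⟨h1, h2⟩ => hx ?_
    rw [← Set.indicator_self_add_compl s x]
    exact add_mem_faceSet (hT h1) (hT h2)

/-- Induction on `x = t + s`. If `t ≠ 0`, erasing `z` turns this into a decomposition with the same
nonzero `t`, so neither vector is in `S`. If `t = 0` and the erased vector had a nonzero `T`-part
`t'`, restoring the `z`-exponent to its `S`-part would, by induction, give a second decomposition of
`x ∈ S`. -/
theorem IsPairOf.mem_iff_indicator_compl_mem [Finite V] (h : IsPairOf (faceSet X) T S) {z : V}
    (hT : ∀ t ∈ T, t z = 0) (x : V → ℕ) (hx : x ∈ faceSet X) :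
    x ∈ S ↔ Set.indicator {z}ᶜ x ∈ S := by
  induction x using WellFoundedLT.induction with
  | ind x ih =>
  have hT0 := h.zero_mem_of_faceSet
  have hS0 := h.symm.zero_mem_of_faceSet
  have hTi : ∀ t ∈ T, Set.indicator {z}ᶜ t = t := by
    intro t ht
    rw [Set.indicator_eq_self]
    intro v hv hvz
    rw [Set.mem_singleton_iff.1 hvz] at hv
    exact hv (hT t ht)
  obtain ⟨t, ht, s, hs, e⟩ := h.exists_add hx
  by_cases ht0 : t = 0
  · subst ht0
    rw [zero_add] at e
    subst e
    refine iff_of_true hs ?_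
    have hle : Set.indicator {z}ᶜ s ≤ s := Set.indicator_le_self _ s
    obtain ⟨t', ht', s', hs', e'⟩ := h.exists_add (mem_faceSet_of_le hx hle)
    by_cases ht0' : t' = 0
    · rw [ht0', zero_add] at e'
      rwa [← e']
    exfalso
    have hsz : s' z = 0 := by
      have := congrFun e' z
      simp only [Pi.add_apply, Set.mem_compl_iff, Set.mem_singleton_iff, not_true,
        not_false_eq_true, Set.indicator_of_notMem] at this
      omega
    have hsum : t' + (s' + Set.indicator {z} s) = s := by
      rw [← add_assoc, e', add_comm, Set.indicator_self_add_compl]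
    have hlt : s' + Set.indicator {z} s < s := by
      refine lt_of_le_of_ne (le_add_self.trans_eq hsum) fun hc => ht0' ?_
      rw [hc] at hsum
      exact add_eq_right.1 hsum
    have hind : Set.indicator {z}ᶜ (s' + Set.indicator {z} s) = s' := by
      ext v
      by_cases hv : v = z
      · subst hv
        simp [hsz]
      · simp [hv]
    have := (ih _ hlt (mem_faceSet_of_le hx hlt.le)).2 (by rwa [hind])
    exact ht0' (h.eq_and_eq ht' hT0 this hs (by rw [hsum, zero_add])).1
  · have hlt : s < x := by
      refine lt_of_le_of_ne (by rw [← e]; exact le_add_self) fun hc => ht0 ?_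
      rw [hc] at e
      exact add_eq_right.1 e
    have hs' := (ih s hlt (mem_faceSet_of_le hx hlt.le)).1 hs
    have e' : t + Set.indicator {z}ᶜ s = Set.indicator {z}ᶜ x := by
      rw [← e, Set.indicator_add', hTi t ht]
    refine iff_of_false (fun hc => ht0 ?_) fun hc => ht0 ?_
    · exact (h.eq_and_eq ht hT0 hs hc (by rw [e, zero_add])).1
    · exact (h.eq_and_eq ht hT0 hs' hc (by rw [e', zero_add])).1

/-- Each variable occurs in both members of a primitive pair in several variables. -/
theorem IsPrimitiveOn.exists_ne_zero [Finite V] (h : IsPrimitiveOn X T S) (hX : X.Nontrivial)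
    {z : V} (hz : z ∈ X) : ∃ t ∈ T, t z ≠ 0 := by
  by_contra! hT
  have hT0 := h.pair.zero_mem_of_faceSet
  have hmem := h.pair.mem_iff_indicator_compl_mem hT
  obtain ⟨w, hw, hwz⟩ := hX.exists_ne z
  -- The variable `z` never occurs in `T`, and membership in `S` does not depend on its exponent; so
  -- both members split at `{z}`.
  refine h.not_splits {z} ⟨z, rfl, hz⟩ ⟨w, hw, hwz⟩
    ⟨splitsAt_of_forall_mem_faceSet h.pair.left_subset fun x _ => ?_,
      splitsAt_of_forall_mem_faceSet h.pair.right_subset fun x hx => ?_⟩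
  · have h1 : ∀ {x : V → ℕ}, x z = 0 →
        Set.indicator {z} x = 0 ∧ Set.indicator {z}ᶜ x = x := by
      intro x hxz
      constructor <;>
      · ext v
        by_cases hv : v = z
        · subst hv; simp [hxz]
        · simp [hv]
    constructor
    · intro hxT
      obtain ⟨h2, h3⟩ := h1 (hT x hxT)
      rw [h2, h3]
      exact ⟨hT0, hxT⟩
    · rintro ⟨h2, h3⟩
      have hxz : x z = 0 := by simpa using hT _ h2
      rwa [(h1 hxz).2] at h3
  · rw [hmem x hx, iff_and_self]
    intro _
    have hle : Set.indicator {z} x ≤ x := Set.indicator_le_self _ x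
    rw [hmem _ (mem_faceSet_of_le hx hle)]
    have : Set.indicator {z}ᶜ (Set.indicator {z} x) = 0 := by
      ext v
      by_cases hv : v = z
      · subst hv; simp
      · simp [hv]
    rw [this]
    exact h.pair.symm.zero_mem_of_faceSet

end Face

/-! ### Extensions preserve primitivity -/

section Extend

variable {V : Type*} {X : Set V} {T S : Set (V → ℕ)} {z : V} {B : Set V} {C D : V → Set ℕ}
  {a N : V → ℕ}

open Classical in
theorem mem_extend_iff {ε : Fin 2} {y : V → ℕ} :
    y ∈ extend z B C a N ε T ↔ ∃ c ∈ box B C, ∃ l ∈ cornerOrZero B a ε, ∃ t ∈ T,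
      (∀ v ∈ B, y v = c v + N v * l v + t z * (a v * N v)) ∧
      ∀ v ∉ B, y v = if v = z then 0 else t v := by
  have hpow : ∀ l, l ∈ cornerPow B a N ε ↔
      ∃ l' ∈ cornerOrZero B a ε, (fun v => N v * l' v) = l := by
    intro l
    unfold cornerPow cornerOrZero
    split_ifs
    · rfl
    · simp only [Set.mem_singleton_iff, exists_eq_left, Pi.zero_apply, mul_zero]
      exact eq_comm
  constructor
  · rintro ⟨_, ⟨c, hc, l, hl, rfl⟩, _, ⟨t, ht, rfl⟩, rfl⟩
    obtain ⟨l, hl', rfl⟩ := (hpow l).1 hl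
    refine ⟨c, hc, l, hl', t, ht, fun v hv => ?_, fun v hv => ?_⟩
    · simp only [Pi.add_apply, substitute, hv, if_true]
    · simp only [Pi.add_apply, substitute, hv, if_false, hc.2 v hv,
        eq_zero_of_mem_cornerOrZero hl' hv, mul_zero, zero_add]
  · rintro ⟨c, hc, l, hl, t, ht, h1, h2⟩
    refine ⟨_, ⟨c, hc, _, (hpow _).2 ⟨l, hl, rfl⟩, rfl⟩, _, ⟨t, ht, rfl⟩, ?_⟩
    ext v
    by_cases hv : v ∈ B
    · simp only [Pi.add_apply, substitute, hv, if_true, h1]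
    · simp only [Pi.add_apply, substitute, hv, if_false, hc.2 v hv,
        eq_zero_of_mem_cornerOrZero hl hv, mul_zero, zero_add, h2 v hv]

theorem cornerOrZero_subset (hB : B.Nonempty) (ha : ∀ v ∈ B, 0 < a v) (ε : Fin 2) :
    cornerOrZero B a ε ⊆ corner B a := by
  unfold cornerOrZero
  split_ifs
  · exact subset_rfl
  · rw [Set.singleton_subset_iff]
    exact zero_mem_corner hB ha

/-- The digit `r` is the residue modulo `N`; the quotient is a base vector plus a corner vector, and
both of these are unique. -/
theorem mixedRadix_unique (hB : B.Nonempty) (ha : ∀ v ∈ B, 0 < a v) {r r' l l' : V → ℕ} {k k' : ℕ}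
    (hr : ∀ v ∈ B, r v < N v) (hr' : ∀ v ∈ B, r' v < N v) (hl : l ∈ corner B a)
    (hl' : l' ∈ corner B a)
    (e : ∀ v ∈ B, r v + N v * l v + k * (a v * N v) = r' v + N v * l' v + k' * (a v * N v)) :
    (∀ v ∈ B, r v = r' v) ∧ l = l' ∧ k = k' := by
  classical
  have hq : ∀ (r l k m n : ℕ), r < n →
      (r + n * l + k * (m * n)) % n = r ∧ (r + n * l + k * (m * n)) / n = k * m + l := by
    intro r l k m n hr
    have e : r + n * l + k * (m * n) = n * (k * m + l) + r := by ring
    rw [e, Nat.mul_add_mod, Nat.mod_eq_of_lt hr, Nat.mul_add_div (by omega), Nat.div_eq_of_lt hr]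
    exact ⟨rfl, rfl⟩
  have h1 : ∀ v ∈ B, r v = r' v ∧ k * a v + l v = k' * a v + l' v := by
    intro v hv
    obtain ⟨h1, h2⟩ := hq (r v) (l v) k (a v) (N v) (hr v hv)
    obtain ⟨h3, h4⟩ := hq (r' v) (l' v) k' (a v) (N v) (hr' v hv)
    rw [e v hv] at h1 h2
    exact ⟨h1.symm.trans h3, h2.symm.trans h4⟩
  let b : ℕ → V → ℕ := fun k v => if v ∈ B then k * a v else 0
  have hb : ∀ k, IsBase B a (b k) := fun k => ⟨k, fun v hv => by simp [b, hv]⟩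
  obtain ⟨h2, h3⟩ := (hb k).eq_of_add_eq (hb k') hl hl' (by
    ext v
    by_cases hv : v ∈ B
    · simpa [b, hv] using (h1 v hv).2
    · simp [b, hv, hl.1 v hv, hl'.1 v hv])
  refine ⟨fun v hv => (h1 v hv).1, h3, ?_⟩
  obtain ⟨j, hj⟩ := hB
  have := congrFun h2 j
  simp only [b, hj, if_true] at this
  exact Nat.eq_of_mul_eq_mul_right (ha j hj) this

theorem extend_subset_faceSet (hT : T ⊆ faceSet X) (ε : Fin 2) :
    extend z B C a N ε T ⊆ faceSet (X \ {z} ∪ B) := by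
  classical
  intro y hy v hv
  obtain ⟨c, hc, l, hl, t, ht, -, h2⟩ := mem_extend_iff.1 hy
  have hvB : v ∉ B := fun h => hv (Or.inr h)
  rw [h2 v hvB]
  split_ifs with hvz
  · rfl
  · exact hT ht v fun h => hv (Or.inl ⟨h, hvz⟩)

/-- Digits are decomposed by the interval pairs, the corner part goes to the first member, and the
multiplier of `a` is decomposed by the old pair as the exponent of `z`. -/
theorem IsPairOf.extend (h : IsPairOf (faceSet X) T S) (hz : z ∈ X) (hBX : Disjoint B X)
    (hB : B.Nonempty) (ha : ∀ v ∈ B, 0 < a v) (hC : ∀ v ∈ B, IsIntervalPair (N v) (C v) (D v)) :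
    IsPairOf (faceSet (X \ {z} ∪ B)) (extend z B C a N 1 T) (extend z B D a N 0 S) := by
  classical
  have hT0 : ∀ t ∈ T, ∀ v ∈ B, t v = 0 := fun t ht v hv =>
    h.left_subset ht v (Set.disjoint_left.1 hBX hv)
  have hS0 : ∀ t ∈ S, ∀ v ∈ B, t v = 0 := fun t ht v hv =>
    h.right_subset ht v (Set.disjoint_left.1 hBX hv)
  have hsub1 := extend_subset_faceSet (z := z) (B := B) (C := C) (a := a) (N := N) h.left_subset 1
  have hsub2 := extend_subset_faceSet (z := z) (B := B) (C := D) (a := a) (N := N) h.right_subset 0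
  refine .of_exists_unique hsub1 hsub2 (fun x hx y hy => add_mem_faceSet (hsub1 hx) (hsub2 hy))
    ?_ ?_
  · intro y hy
    obtain ⟨b, l, ⟨k, hk⟩, hl, hbl⟩ := exists_isBase_add_corner hB ha (y / N)
    have hcd : ∀ v, ∃ c d, (v ∈ B → c ∈ C v ∧ d ∈ D v ∧ c + d = y v % N v) ∧
        (v ∉ B → c = 0 ∧ d = 0) := by
      intro v
      by_cases hv : v ∈ B
      · obtain ⟨c, hc, d, hd, e⟩ := (hC v hv).pair.exists_add
          (Set.mem_Iio.2 (Nat.mod_lt (y v) (hC v hv).one_le_size))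
        exact ⟨c, d, fun _ => ⟨hc, hd, e⟩, fun hc => absurd hv hc⟩
      · exact ⟨0, 0, fun hc => absurd hc hv, fun _ => ⟨rfl, rfl⟩⟩
    choose c d hcd hcd0 using hcd
    -- The old pair decomposes the vector carrying the multiplier `k` at `z` and the exponents of
    -- `y` at the other old variables.
    obtain ⟨t, ht, s, hs, e⟩ := h.exists_add
      (c := fun v => if v = z then k else if v ∈ B then 0 else y v) (by
        intro v hv
        have hvz : v ≠ z := fun e => hv (e ▸ hz)
        simp only [hvz, if_false]
        split_ifs with hvB
        · rfl
        · exact hy v fun hc => hc.elim (fun h => hv h.1) hvB)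
    have hzk : t z + s z = k := by simpa using congrFun e z
    refine ⟨fun v => if v ∈ B then c v + N v * l v + t z * (a v * N v) else
        if v = z then 0 else t v,
      mem_extend_iff.2 ⟨c, ⟨fun v hv => (hcd v hv).1, fun v hv => (hcd0 v hv).1⟩, l, by
        simpa [cornerOrZero] using hl, t, ht, fun v hv => by simp [hv], fun v hv => by simp [hv]⟩,
      fun v => if v ∈ B then d v + N v * 0 + s z * (a v * N v) else if v = z then 0 else s v,
      mem_extend_iff.2 ⟨d, ⟨fun v hv => (hcd v hv).2.1, fun v hv => (hcd0 v hv).2⟩, 0, by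
        simp [cornerOrZero], s, hs, fun v hv => by simp [hv], fun v hv => by simp [hv]⟩, ?_⟩
    ext v
    by_cases hv : v ∈ B
    · have h1 := (hcd v hv).2.2
      have h2 : b v + l v = y v / N v := congrFun hbl v
      have h3 := Nat.div_add_mod (y v) (N v)
      rw [← h1, ← h2, hk v hv, ← hzk] at h3
      simp only [Pi.add_apply, hv, if_true]
      rw [← h3]
      ring
    · by_cases hvz : v = z
      · subst hvz
        have hyv : y v = 0 := hy v fun hc => hc.elim (fun h => h.2 rfl) hv
        simp [hv, hyv]
      · have := congrFun e v
        simp only [Pi.add_apply, hv, hvz, if_false] at this ⊢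
        exact this
  · intro x hx x' hx' y hy y' hy' e
    obtain ⟨c, hc, l, hl, t, ht, h1, h2⟩ := mem_extend_iff.1 hx
    obtain ⟨c', hc', l', hl', t', ht', h1', h2'⟩ := mem_extend_iff.1 hx'
    obtain ⟨d, hd, m, hm, s, hs, h3, h4⟩ := mem_extend_iff.1 hy
    obtain ⟨d', hd', m', hm', s', hs', h3', h4'⟩ := mem_extend_iff.1 hy'
    obtain rfl : m = 0 := by simpa [cornerOrZero] using hm
    obtain rfl : m' = 0 := by simpa [cornerOrZero] using hm'
    obtain ⟨e1, rfl, e2⟩ := mixedRadix_unique (N := N) hB ha (r := c + d) (r' := c' + d')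
      (k := t z + s z) (k' := t' z + s' z)
      (fun v hv => (hC v hv).pair.add_mem (hc.1 v hv) (hd.1 v hv))
      (fun v hv => (hC v hv).pair.add_mem (hc'.1 v hv) (hd'.1 v hv))
      (cornerOrZero_subset hB ha _ hl) (cornerOrZero_subset hB ha _ hl') (by
        intro v hv
        have := congrFun e v
        simp only [Pi.add_apply, h1 v hv, h1' v hv, h3 v hv, h3' v hv, Pi.zero_apply] at this ⊢
        linarith)
    have hts : t + s = t' + s' := by
      ext v
      by_cases hv : v ∈ B
      · simp only [Pi.add_apply, hT0 t ht v hv, hT0 t' ht' v hv, hS0 s hs v hv, hS0 s' hs' v hv]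
      · by_cases hvz : v = z
        · subst hvz
          exact e2
        · have := congrFun e v
          simpa only [Pi.add_apply, h2 v hv, h2' v hv, h4 v hv, h4' v hv, hvz, if_false] using this
    obtain ⟨rfl, rfl⟩ := h.eq_and_eq ht ht' hs hs' hts
    have hcd : ∀ v ∈ B, c v = c' v ∧ d v = d' v := fun v hv =>
      (hC v hv).pair.eq_and_eq (hc.1 v hv) (hc'.1 v hv) (hd.1 v hv) (hd'.1 v hv) (e1 v hv)
    constructor
    · ext v
      by_cases hv : v ∈ B
      · rw [h1 v hv, h1' v hv, (hcd v hv).1]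
      · rw [h2 v hv, h2' v hv]
    · ext v
      by_cases hv : v ∈ B
      · rw [h3 v hv, h3' v hv, (hcd v hv).2]
      · rw [h4 v hv, h4' v hv]

/-- The old members sit in the extended ones as the vectors with zero digits and zero corner part,
so statements about the extension can be pulled back. -/
theorem substitute_mem_extend_iff (hT : T ⊆ faceSet X) (hBX : Disjoint B X)
    (hB : B.Nonempty) (ha : ∀ v ∈ B, 0 < a v) (hC : ∀ v ∈ B, IsIntervalPair (N v) (C v) (D v))
    (ε : Fin 2) {t : V → ℕ} (ht : t ∈ faceSet X) :
    substitute z B (fun v => a v * N v) t ∈ extend z B C a N ε T ↔ t ∈ T := by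
  classical
  have hzero := zero_mem_corner hB ha
  rw [mem_extend_iff]
  constructor
  · rintro ⟨c, hc, l, hl, t', ht', h1, h2⟩
    obtain ⟨-, -, e⟩ := mixedRadix_unique (N := N) hB ha (r := 0) (r' := c) (k := t z)
      (k' := t' z) (fun v hv => (hC v hv).one_le_size)
      (fun v hv => (hC v hv).lt (hc.1 v hv)) hzero (cornerOrZero_subset hB ha _ hl) (by
        intro v hv
        rw [← h1 v hv]
        simp [substitute, hv])
    suffices t = t' by rwa [this]
    ext v
    by_cases hv : v ∈ B
    · have hvX := Set.disjoint_left.1 hBX hv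
      rw [ht v hvX, hT ht' v hvX]
    · by_cases hvz : v = z
      · subst hvz
        exact e
      · have := h2 v hv
        simpa [substitute, hv, hvz] using this
  · intro htT
    refine ⟨0, ⟨fun v hv => (hC v hv).zero_mem, fun _ _ => rfl⟩, 0, ?_, t, htT, fun v hv => ?_,
      fun v hv => ?_⟩
    · unfold cornerOrZero
      split_ifs
      · exact hzero
      · rfl
    · simp [substitute, hv]
    · simp [substitute, hv]

theorem indicator_substitute (s : Set V) (b t : V → ℕ) (hBs : B ⊆ s) :
    s.indicator (substitute z B b t) = substitute z B b ((insert z s).indicator t) ∧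
      sᶜ.indicator (substitute z B b t) = substitute z B b ((insert z s)ᶜ.indicator t) := by
  classical
  constructor <;>
  · ext v
    by_cases hv : v ∈ B
    · have := hBs hv
      simp [substitute, hv, this]
    · by_cases hvz : v = z
      · subst hvz
        by_cases hs : v ∈ s <;> simp [substitute, hv, hs]
      · by_cases hs : v ∈ s <;> simp [substitute, hv, hs, hvz]

/-- When `B ⊆ s`, restriction to `s` commutes with the substitution, `z` being counted on the side
of `B`. -/
theorem SplitsAt.of_extend (hT : T ⊆ faceSet X) (hBX : Disjoint B X)
    (hB : B.Nonempty) (ha : ∀ v ∈ B, 0 < a v) (hC : ∀ v ∈ B, IsIntervalPair (N v) (C v) (D v))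
    {ε : Fin 2} {s : Set V} (hBs : B ⊆ s) (h : SplitsAt s (extend z B C a N ε T)) :
    SplitsAt (insert z s) T := by
  refine splitsAt_of_forall_mem_faceSet hT fun t ht => ?_
  have hle : ∀ s : Set V, s.indicator t ∈ faceSet X := fun s =>
    mem_faceSet_of_le ht (Set.indicator_le_self s t)
  have hiff := fun {t : V → ℕ} => substitute_mem_extend_iff (z := z) (t := t) hT hBX hB ha hC ε
  rw [← hiff ht, ← hiff (hle _), ← hiff (hle _), h, (indicator_substitute s _ t hBs).1,
    (indicator_substitute s _ t hBs).2]

/-- A splitting either separates two variables of `B`, which `hS` rules out, or has `B` on one side,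
and then it descends to the old pair. -/
theorem IsPrimitiveOn.extend_one (h : IsPrimitiveOn X T S) (hz : z ∈ X) (hBX : Disjoint B X)
    (hB : B.Nonempty) (ha : ∀ v ∈ B, 0 < a v) (hC : ∀ v ∈ B, IsIntervalPair (N v) (C v) (D v))
    (hS : ∃ s ∈ S, s z ≠ 0) :
    IsPrimitiveOn (X \ {z} ∪ B) (extend z B C a N 1 T) (extend z B D a N 0 S) := by
  classical
  have hDC := fun v hv => (hC v hv).symm
  -- Restricting the image of `u` to `s` kills its exponent at `w`, so the multiplier is `0`. The
  -- exponent at `v` would then be a digit, smaller than `N v`, although `u z ≠ 0` makes it at least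
  -- `N v`.
  have hmix : ∀ s : Set V, ∀ v ∈ B, ∀ w ∈ B, v ∈ s → w ∉ s →
      ¬ SplitsAt s (extend z B D a N 0 S) := by
    intro s v hv w hw hvs hws hsp
    obtain ⟨u, hu, huz⟩ := hS
    have h1 := (hsp _).1 ((substitute_mem_extend_iff (z := z) h.pair.right_subset hBX hB ha hDC 0
      (h.pair.right_subset hu)).2 hu)
    obtain ⟨d, hd, l, hl, u', -, h2, -⟩ := mem_extend_iff.1 h1.1
    obtain rfl : l = 0 := by simpa [cornerOrZero] using hl
    have hw' := h2 w hw
    rw [Set.indicator_of_notMem hws] at hw'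
    have hv' := h2 v hv
    rw [Set.indicator_of_mem hvs] at hv'
    have hu' : u' z = 0 := by
      have h3 : u' z * (a w * N w) = 0 := by omega
      have h4 := Nat.mul_pos (ha w hw) (hC w hw).one_le_size
      exact (Nat.mul_eq_zero.1 h3).resolve_right h4.ne'
    simp only [substitute, hv, if_true, hu', Pi.zero_apply, mul_zero, zero_mul, add_zero] at hv'
    have h5 : d v < N v := (hC v hv).symm.lt (hd.1 v hv)
    have h6 : 1 * (1 * N v) ≤ u z * (a v * N v) :=
      Nat.mul_le_mul (Nat.one_le_iff_ne_zero.2 huz) (Nat.mul_le_mul_right _ (ha v hv))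
    omega
  have hsub : ∀ s : Set V, B ⊆ s → ((X \ {z} ∪ B) \ s).Nonempty →
      ¬ (SplitsAt s (extend z B C a N 1 T) ∧ SplitsAt s (extend z B D a N 0 S)) := by
    rintro s hBs ⟨w, hw, hws⟩ ⟨h1, h2⟩
    have hwX := hw.resolve_right fun hc => hws (hBs hc)
    refine h.not_splits (insert z s) ⟨z, Set.mem_insert z s, hz⟩ ⟨w, hwX.1, ?_⟩
      ⟨h1.of_extend h.pair.left_subset hBX hB ha hC hBs,
        h2.of_extend h.pair.right_subset hBX hB ha hDC hBs⟩
    rintro (hc | hc)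
    · exact hwX.2 hc
    · exact hws hc
  refine ⟨h.pair.extend hz hBX hB ha hC, fun s hs1 hs2 ⟨hT', hS'⟩ => ?_⟩
  by_cases hBs : B ⊆ s
  · exact hsub s hBs hs2 ⟨hT', hS'⟩
  · obtain ⟨w, hw, hws⟩ := Set.not_subset.1 hBs
    by_cases hBs' : ∃ v ∈ B, v ∈ s
    · obtain ⟨v, hv, hvs⟩ := hBs'
      exact hmix s v hv w hw hvs hws hS'
    · refine hsub sᶜ (fun v hv hc => hBs' ⟨v, hv, hc⟩) ?_ ⟨hT'.compl, hS'.compl⟩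
      obtain ⟨x, hx1, hx2⟩ := hs1
      exact ⟨x, hx2, fun hc => hc hx1⟩

theorem IsPrimitiveOn.extend (h : IsPrimitiveOn X T S) (hz : z ∈ X) (hBX : Disjoint B X)
    (hB : B.Nonempty) (ha : ∀ v ∈ B, 0 < a v) (hC : ∀ v ∈ B, IsIntervalPair (N v) (C v) (D v))
    {ε : Fin 2} (hT : ε = 0 → ∃ t ∈ T, t z ≠ 0) (hS : ε = 1 → ∃ s ∈ S, s z ≠ 0) :
    IsPrimitiveOn (X \ {z} ∪ B) (extend z B C a N ε T) (extend z B D a N (1 - ε) S) := by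
  have hε : ε = 0 ∨ ε = 1 := by omega
  rcases hε with rfl | rfl
  · exact (h.symm.extend_one hz hBX hB ha (fun v hv => (hC v hv).symm) (hT rfl)).symm
  · exact h.extend_one hz hBX hB ha hC (hS rfl)

end Extend

/-! ### Tops of subtrees -/

namespace RootedTree

variable {V : Type*} (Γ : RootedTree V)

/-- The tops of the subtree with node set `U`. -/
def topsIn (U : Set V) : Set V := {v | v ∈ U ∧ Disjoint (Γ.offspring v) U}

theorem notMem_offspring_self (v : V) : v ∉ Γ.offspring v := fun h => h.1.ne rfl

theorem root_notMem_offspring (v : V) : Γ.root ∉ Γ.offspring v := by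
  intro h
  have := h.2
  simp [level] at this

/-- Shortest walks to `u` and `v`, each prolonged to `w`, are both paths from the root to `w`. Paths
in a tree are unique, so their penultimate nodes agree. -/
theorem eq_of_mem_offspring {u v w : V} (hu : w ∈ Γ.offspring u) (hv : w ∈ Γ.offspring v) :
    u = v := by
  obtain ⟨p, hp⟩ := Γ.isTree.1.exists_walk_length_eq_dist Γ.root u
  obtain ⟨q, hq⟩ := Γ.isTree.1.exists_walk_length_eq_dist Γ.root v
  have hp' : (p.concat hu.1).IsPath := by
    apply SimpleGraph.Walk.isPath_of_length_eq_dist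
    rw [SimpleGraph.Walk.length_concat, hp]
    exact hu.2.symm
  have hq' : (q.concat hv.1).IsPath := by
    apply SimpleGraph.Walk.isPath_of_length_eq_dist
    rw [SimpleGraph.Walk.length_concat, hq]
    exact hv.2.symm
  have e := congrArg Subtype.val ((Γ.isTree.2.subsingleton_path _ _).elim
    (⟨_, hp'⟩ : Γ.graph.Path _ _) ⟨_, hq'⟩)
  have := congrArg SimpleGraph.Walk.penultimate e
  simpa using this

/-- Restoring the offsprings of `z` can spoil no other top, because each of them has only one
parent. -/
theorem topsIn_eq {U : Set V} {z : V} (mem : z ∈ U) (nonempty : (Γ.offspring z).Nonempty)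
    (subset : Γ.offspring z ⊆ U) (tops : ∀ x ∈ Γ.offspring z, Disjoint (Γ.offspring x) U) :
    Γ.topsIn U = Γ.topsIn (U \ Γ.offspring z) \ {z} ∪ Γ.offspring z := by
  ext v
  constructor
  · rintro ⟨h1, h2⟩
    by_cases hv : v ∈ Γ.offspring z
    · exact Or.inr hv
    · refine Or.inl ⟨⟨⟨h1, hv⟩, h2.mono_right Set.sdiff_subset⟩, ?_⟩
      rintro rfl
      obtain ⟨w, hw⟩ := nonempty
      exact Set.disjoint_left.1 h2 hw (subset hw)
  · rintro (⟨⟨h1, h2⟩, hvz⟩ | h)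
    · refine ⟨h1.1, Set.disjoint_left.2 fun w hw hwU => ?_⟩
      refine Set.disjoint_left.1 h2 hw ⟨hwU, fun hwz => hvz ?_⟩
      exact Γ.eq_of_mem_offspring hw hwz
    · exact ⟨subset h, tops v h⟩

theorem mem_topsIn_sdiff {U : Set V} {z : V} (mem : z ∈ U) :
    z ∈ Γ.topsIn (U \ Γ.offspring z) :=
  ⟨⟨mem, Γ.notMem_offspring_self z⟩, Set.disjoint_sdiff_right⟩

end RootedTree

/-! ### Every weighted tree generates a primitive pair -/

section Forward

variable {V : Type*} {Γ : RootedTree V}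

theorem box_eq_preimage (r : V) (R : Set ℕ) {y : V → ℕ} :
    y ∈ box {r} (fun _ => R) ↔ y r ∈ R ∧ y ∈ faceSet {r} := by
  simp only [box, faceSet, Set.mem_singleton_iff, forall_eq]
  rfl

theorem isPrimitiveOn_singleton (r : V) {T₀ S₀ : Set ℕ} (h : IsPairOf Set.univ T₀ S₀) :
    IsPrimitiveOn {r} (box {r} fun _ => T₀) (box {r} fun _ => S₀) := by
  classical
  have hsingle : ∀ k, (Pi.single r k : V → ℕ) ∈ faceSet {r} := fun k v hv => by
    rw [Pi.single_eq_of_ne hv]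
  have heq : ∀ {y y' : V → ℕ}, y ∈ faceSet {r} → y' ∈ faceSet {r} → y r = y' r → y = y' := by
    intro y y' hy hy' e
    ext v
    by_cases hv : v = r
    · rw [hv, e]
    · rw [hy v hv, hy' v hv]
  refine ⟨.of_exists_unique (fun y hy => hy.2) (fun y hy => hy.2)
    (fun x hx y hy => add_mem_faceSet hx.2 hy.2) ?_ ?_, ?_⟩
  · intro y hy
    obtain ⟨t, ht, s, hs, e⟩ := h.exists_add (Set.mem_univ (y r))
    refine ⟨Pi.single r t, (box_eq_preimage r _).2 ⟨by simpa using ht, hsingle t⟩, Pi.single r s,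
      (box_eq_preimage r _).2 ⟨by simpa using hs, hsingle s⟩,
      heq (add_mem_faceSet (hsingle t) (hsingle s)) hy ?_⟩
    simpa using e
  · intro x hx x' hx' y hy y' hy' e
    rw [box_eq_preimage] at hx hx' hy hy'
    have := h.eq_and_eq hx.1 hx'.1 hy.1 hy'.1 (congrFun e r)
    exact ⟨heq hx.2 hx'.2 this.1, heq hy.2 hy'.2 this.2⟩
  · rintro s ⟨x, hx, hxr⟩ ⟨y, hyr, hy⟩ _
    rw [Set.mem_singleton_iff] at hxr hyr
    subst hxr
    exact hy (hyr ▸ hx)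

theorem exists_mem_box_ne_zero (r : V) {R : Set ℕ} (h0 : 0 ∈ R) (h : R ≠ {0}) :
    ∃ y ∈ box {r} (fun _ => R), y r ≠ 0 := by
  classical
  obtain ⟨k, hk, hk0⟩ : ∃ k ∈ R, k ≠ 0 := by
    by_contra! hc
    exact h (Set.eq_singleton_iff_unique_mem.2 ⟨h0, hc⟩)
  refine ⟨Pi.single r k, (box_eq_preimage r R).2 ⟨by simpa using hk, fun v hv => ?_⟩, by simpa⟩
  rw [Pi.single_eq_of_ne hv]

/-- The alternative carried along decides why `z` occurs in the required member at the next
extension: at the root alone by the weight constraints, and with several tops by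
`IsPrimitiveOn.exists_ne_zero`. Branching provides several tops after any extension. -/
theorem Generates.isPrimitiveOn [Finite V] (hbr : Γ.IsBranching) {W : Weight Γ} {U : Set V}
    {T S : Set (V → ℕ)} (h : Generates W U T S) :
    IsPrimitiveOn (Γ.topsIn U) T S ∧
      ((U = {Γ.root} ∧ T = box {Γ.root} (fun _ => W.T₀) ∧ S = box {Γ.root} fun _ => W.S₀) ∨
        (Γ.topsIn U).Nontrivial) := by
  induction h with
  | root =>
    have : Γ.topsIn {Γ.root} = {Γ.root} := by
      ext v
      refine ⟨fun h => h.1, fun h => ⟨h, Set.disjoint_singleton_right.2 ?_⟩⟩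
      exact Γ.root_notMem_offspring v
    rw [this]
    exact ⟨isPrimitiveOn_singleton _ W.initial, Or.inl ⟨rfl, rfl, rfl⟩⟩
  | branch U z T S mem nonempty subset tops _ ih =>
    obtain ⟨hp, hor⟩ := ih
    have hzt : ¬ Γ.IsTop z := nonempty.ne_empty
    have hnt : (Γ.offspring z).Nontrivial := hbr z hzt
    have hz := Γ.mem_topsIn_sdiff mem
    have hroot : ∀ v ∈ Γ.offspring z, v ≠ Γ.root := by
      rintro v hv rfl
      exact Γ.root_notMem_offspring z hv
    rw [Γ.topsIn_eq mem nonempty subset tops]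
    have hex : (W.δ z = 0 → ∃ t ∈ T, t z ≠ 0) ∧ (W.δ z = 1 → ∃ s ∈ S, s z ≠ 0) := by
      rcases hor with ⟨hU, rfl, rfl⟩ | hX
      · have hzr : z = Γ.root := by
          have : z ∈ U \ Γ.offspring z := ⟨mem, Γ.notMem_offspring_self z⟩
          rwa [hU] at this
        subst hzr
        constructor
        · intro hδ
          refine exists_mem_box_ne_zero _
            (W.initial.zero_mem (Set.mem_univ _) fun a b => by omega) fun hc => ?_
          rw [W.δ_root_of_left hzt hc] at hδ
          exact absurd hδ (by decide)
        · intro hδ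
          refine exists_mem_box_ne_zero _
            (W.initial.symm.zero_mem (Set.mem_univ _) fun a b => by omega) fun hc => ?_
          rw [W.δ_root_of_right hzt hc] at hδ
          exact absurd hδ (by decide)
      · exact ⟨fun _ => hp.exists_ne_zero hX hz, fun _ => hp.symm.exists_ne_zero hX hz⟩
    refine ⟨hp.extend hz ?_ nonempty (fun v hv => W.α_pos v (hroot v hv))
      (fun v hv => W.interval v (hroot v hv)) hex.1 hex.2,
      Or.inr (hnt.mono Set.subset_union_right)⟩
    exact Set.disjoint_left.2 fun v hv hc => hc.1.2 hv

/-- On the face of `Set.range f`, reading exponents along `f` is inverse to `pushVec f`, so pairs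
and splittings correspond. -/
theorem IsPrimitiveOn.isPrimitiveNPair {ι : Type*} {f : ι → V} (hf : Function.Injective f)
    {T S : Set (V → ℕ)} (h : IsPrimitiveOn (Set.range f) T S) :
    IsPrimitiveNPair ((fun y i => y (f i)) '' T) ((fun y i => y (f i)) '' S) := by
  have hpush : ∀ {y : V → ℕ}, y ∈ faceSet (Set.range f) → pushVec f (fun i => y (f i)) = y :=
    fun hy => (eq_pushVec hf (fun _ => rfl) hy).symm
  have hface : ∀ x : ι → ℕ, pushVec f x ∈ faceSet (Set.range f) := fun x v hv =>
    pushVec_notMem x hv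
  have himg : ∀ {R : Set (V → ℕ)}, R ⊆ faceSet (Set.range f) →
      (fun y i => y (f i)) '' R = pushVec f ⁻¹' R := by
    intro R hR
    ext x
    constructor
    · rintro ⟨y, hy, rfl⟩
      rwa [Set.mem_preimage, hpush (hR hy)]
    · intro hx
      exact ⟨_, hx, funext fun i => pushVec_apply hf x i⟩
  have hinj : Function.Injective (pushVec f) := by
    intro x x' e
    ext i
    rw [← pushVec_apply hf x, e, pushVec_apply hf]
  rw [himg h.pair.left_subset, himg h.pair.right_subset]
  have hp : IsNPair (pushVec f ⁻¹' T) (pushVec f ⁻¹' S) := by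
    refine IsPairOf.of_exists_unique (Set.subset_univ _) (Set.subset_univ _)
      (fun _ _ _ _ => Set.mem_univ _) ?_ ?_
    · intro c _
      obtain ⟨t, ht, s, hs, e⟩ := h.pair.exists_add (hface c)
      have ht' := hpush (h.pair.left_subset ht)
      have hs' := hpush (h.pair.right_subset hs)
      refine ⟨_, by rwa [Set.mem_preimage, ht'], _, by rwa [Set.mem_preimage, hs'], hinj ?_⟩
      rw [map_add, ht', hs', e]
    · intro t ht t' ht' s hs s' hs' e
      have := h.pair.eq_and_eq ht ht' hs hs' (by rw [← map_add, ← map_add, e])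
      exact ⟨hinj this.1, hinj this.2⟩
  refine ⟨hp, ?_⟩
  rw [hp.isCartesianProduct_iff]
  rintro ⟨s, ⟨i, hi⟩, ⟨j, hj⟩, hT, hS⟩
  have hsp : ∀ {R : Set (V → ℕ)}, R ⊆ faceSet (Set.range f) → SplitsAt s (pushVec f ⁻¹' R) →
      SplitsAt (f '' s) R := by
    intro R hR hsp
    refine splitsAt_of_forall_mem_faceSet hR fun y hy => ?_
    have h1 : (f '' s).indicator y = pushVec f (s.indicator fun i => y (f i)) := by
      refine eq_pushVec hf (fun v => ?_) fun v hv => ?_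
      · by_cases hv : v ∈ s <;> simp [hf.mem_set_image, hv]
      · exact Set.indicator_of_notMem (notMem_image_of_notMem_range hv) y
    have h2 : (f '' s)ᶜ.indicator y = pushVec f (sᶜ.indicator fun i => y (f i)) := by
      refine eq_pushVec hf (fun v => ?_) fun v hv => ?_
      · by_cases hv : v ∈ s <;> simp [hf.mem_set_image, hv]
      · rw [Set.indicator_of_mem (notMem_image_of_notMem_range hv), hy v hv]
    rw [h1, h2]
    have := hsp fun i => y (f i)
    rwa [Set.mem_preimage, hpush hy] at this
  refine h.not_splits (f '' s) ⟨f i, ⟨i, hi, rfl⟩, i, rfl⟩ ⟨f j, ⟨j, rfl⟩, ?_⟩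
    ⟨hsp h.pair.left_subset hT, hsp h.pair.right_subset hS⟩
  rw [hf.mem_set_image]
  exact hj

end Forward

end NPair

theorem mainTheorem2 (n : ℕ) (hn : 1 ≤ n) (T S : Set (Fin n → ℕ)) :
    NPair.IsPrimitiveNPair T S ↔
      ∃ (V : Type) (_ : Finite V) (Γ : NPair.RootedTree V) (W : NPair.Weight Γ)
        (e : Fin n ≃ {v : V // Γ.IsTop v}),
        Γ.IsBranching ∧ NPair.IsGeneratedBy W e T S := by
  constructor
  · intro h
    have : Nonempty (Fin n) := ⟨⟨0, hn⟩⟩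
    obtain ⟨V, hV, P, W, e, hbr, hgen, -⟩ := h.isRealizable
    exact ⟨V, hV, P.toRootedTree, W, e, hbr, hgen⟩
  · rintro ⟨V, _, Γ, W, e, hbr, T', S', hgen, rfl, rfl⟩
    have hrange : Γ.topsIn Set.univ = Set.range fun i => (e i : V) := by
      ext v
      simp only [NPair.RootedTree.topsIn, Set.mem_range]
      constructor
      · rintro ⟨-, hv⟩
        exact ⟨e.symm ⟨v, Set.disjoint_univ.1 hv⟩, by simp⟩
      · rintro ⟨i, rfl⟩
        exact ⟨Set.mem_univ _, Set.disjoint_univ.2 (e i).2⟩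
    have h := (hgen.isPrimitiveOn hbr).1
    rw [hrange] at h
    exact h.isPrimitiveNPair (Subtype.val_injective.comp e.injective)
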